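/- **Setting.** Let $V$ be a real Banach space whose tensor powers carry admissible norms: norms on $V^{\otimes n}$ ($n\ge 0$), equal to $|\cdot|$ on $V^{\otimes 0}=\mathbb R$ and to the given norm on $V^{\otimes 1}=V$, invariant under permutation of the factors, with $\|v\otimes w\|\le\|v\|\,\|w\|$; $V^{\otimes n}$ denotes the completion. Let $J=[S,T]$ be a compact interval, $\triangle_J=\{(s,t)\in J^2: s\le t\}$, $T^{(n)}(V)=\bigoplus_{k=0}^n V^{\otimes k}$ with product $(a\otimes b)^k=\sum_{i+j=k}a^i\otimes b^j$, $\mathbb 1=(1,0,\dots,0)$ and $x!=\Gamma(x+1)$. A control is a continuous $\omega:\triangle_J\to[0,\infty)$ with $\omega(t,t)=0$ and $\omega(s,u)+\omega(u,t)\le\omega(s,t)$ for $s\le u\le t$. For $p\ge1$ put $\beta(p)=p\bigl(1+\sum_{r\ge3}(2/(r-2))^{(\lfloor p\rfloor+1)/p}\bigr)$. For $p\ge1$, $X:\triangle_J\to T^{(n)}(V)$ has finite $p$-variation controlled by $\omega$ with constant $K\geq 0$ if $\|X^i_{s,t}\|\le K\,\omega(s,t)^{i/p}/(\beta(p)(i/p)!)$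 for $1\le i\le n$ and all $(s,t)\in\triangle_J$. $\Omega^{(n,p)}(V)$ is the set of continuous $X$ with $X^0=1$ and $X_{s,u}\otimes X_{u,t}=X_{s,t}$ for $s\le u\le t$ that have finite $p$-variation controlled by some control with some constant. For $\theta>1$ and a control $\omega$, $\Omega^{\mathrm{am},(n,p)}_{\theta,\omega}(V)$ is the set of $X:\triangle_J\to T^{(n)}(V)$ with $X^0=1$ for which there is $K\ge0$ such that $X$ has finite $p$-variation controlled by $\omega$ with constant $K$ and $\|(X_{s,u}\otimes X_{u,t}-X_{s,t})^i\|\le K\omega(s,t)^\theta$ for $1\le i\le n$, $s\le u\le t$. For such $X$, the sewing $\mathscr S(X)$ is the $Y\in\Omega^{(n,p)}(V)$ with $\|Y^i_{s,t}-X^i_{s,t}\|\le C\omega(s,t)^\theta$ for some constant $C$, all $1\le i\le n$ and all $(s,t)\in\triangle_J$. For $X\in\Omega^{(n,r)}(V)$ with $1\le r<n+1$, $\mathrm{Ext}_n(X)$ is the $Y\in\Omega^{(n+1,r)}(V)$ whose levels $0,\dots,n$ are those of $X$. Fix $p\ge1$ and write $m=\lfloor p\rfloor$. $\mathscr H^p(V)$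 is the set of $H\in\Omega^{(m,p)}(V)$ for which there are $K\ge0$, a control $\omega$ and $\phi\in(1-\frac1p,1]$ with $\|H^j_{s,t}\|\le K\omega(s,t)^\phi$ for $1\le j\le m$ and all $(s,t)\in\triangle_J$. $\mathfrak I^p(V)$ is the set of $I=(0,I^1,\dots,I^m):\triangle_J\to T^{(m)}(V)$ that are additive ($I_{s,u}+I_{u,t}=I_{s,t}$) and for which there are $K\ge0$, a control $\omega$ and $\phi\in(1-\frac1p,1]$ with $\|I^j_{s,t}\|\le K\omega(s,t)^\phi$ for $1\le j\le m$ and $\|I^m_{s,t}\|\le K\omega(s,t)^{m/p}$, for all $(s,t)\in\triangle_J$. Define $\mathrm{dev}(H)=(0,H^1,H^2-E^2,\dots,H^m-E^m)$ with $E^{j+1}=\mathrm{Ext}_j(1,H^1,\dots,H^j)^{j+1}$, and recursively $\mathbb 1^{(0,I^1)}=(1,I^1)$, $\mathbb 1^{(0,I^1,\dots,I^k)}=\mathrm{Ext}_{k-1}(\mathbb 1^{(0,I^1,\dots,I^{k-1})})+(0,\dots,0,I^k)$. For $H,\widetilde H\in\mathscr H^p(V)$ and $a\in\mathbb R$ set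 $$H\oplus\widetilde H=H+\widetilde H-\mathbb 1,\qquad H\boxplus\widetilde H=\mathscr S(H\oplus\widetilde H),\qquad a\odot H=\mathbb 1^{a\,\mathrm{dev}(H)}.$$ **Theorem.** For every $p\ge1$ these objects are well defined and $(\mathscr H^p(V),\boxplus,\odot)$ is a real vector space with zero $\mathbb 1$. In detail: 1. $\mathfrak I^p(V)$ is a linear space under pointwise operations. 2. For $H\in\mathscr H^p(V)$ and $1\le k<m$, $(1,H^1,\dots,H^k)$ lies in $\Omega^{(k,r)}(V)$ for some $r\in[1,k+1)$; for each such $r$ it has exactly one extension in $\Omega^{(k+1,r)}(V)$, and this extension does not depend on $r$. 3. The lift $I\mapsto\mathbb 1^I$ is a bijection $\mathfrak I^p(V)\to\mathscr H^p(V)$ with inverse $\mathrm{dev}$. 4. For $H,\widetilde H\in\mathscr H^p(V)$ there are $\theta>1$ and a control $\omega$ with $H\oplus\widetilde H\in\Omega^{\mathrm{am},(m,p)}_{\theta,\omega}(V)$. Whenever $H\oplus\widetilde H\in\Omega^{\mathrm{am},(m,r)}_{\theta,\omega}(V)$ with $r\ge1$, $\theta>1$ and $\omega$ a control, its sewing exists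 and is unique, and it does not depend on $(r,\theta,\omega)$. 5. $\boxplus$ and $\odot$ map into $\mathscr H^p(V)$ and make it a real vector space whose zero is $\mathbb 1$. -/

import Mathlib

open scoped TensorProduct

noncomputable section

namespace RoughPath

/-! ### Tensor powers of a Banach space with admissible norms -/

/-- A choice of admissible norms on the tensor powers of `V`: a norm on every algebraic tensor
power (the absolute value on `V^{⊗0} = ℝ`, the given norm on `V^{⊗1} = V`) which is invariant
under permutations of the factors and satisfies `‖v ⊗ w‖ ≤ ‖v‖ ‖w‖`. The projective and the
injective norms are examples. -/
structure AdmissibleNorms (V : Type*) [NormedAddCommGroup V] [NormedSpace ℝ V] where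
  /-- the norm on the `n`-th algebraic tensor power -/
  nrm : ∀ n : ℕ, Seminorm ℝ (⨂[ℝ]^n V)
  eq_zero_of_nrm : ∀ (n : ℕ) (x : ⨂[ℝ]^n V), nrm n x = 0 → x = 0
  nrm_scalar : ∀ c : ℝ, nrm 0 (TensorPower.algebraMap₀ c) = |c|
  nrm_vector : ∀ v : V, nrm 1 (PiTensorProduct.tprod ℝ fun _ => v) = ‖v‖
  nrm_perm : ∀ (n : ℕ) (σ : Equiv.Perm (Fin n)) (x : ⨂[ℝ]^n V),
    nrm n (PiTensorProduct.reindex ℝ (fun _ => V) σ x) = nrm n x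
  nrm_mul_le : ∀ (i j : ℕ) (x : ⨂[ℝ]^i V) (y : ⨂[ℝ]^j V),
    nrm (i + j) (GradedMonoid.GMul.mul (A := fun n => ⨂[ℝ]^n V) x y) ≤ nrm i x * nrm j y

variable {V : Type*} [NormedAddCommGroup V] [NormedSpace ℝ V]

/-- The algebraic tensor power `V^{⊗n}`, carrying the chosen admissible norm. -/
def AdmissibleNorms.Alg (_N : AdmissibleNorms V) (n : ℕ) : Type _ := ⨂[ℝ]^n V

instance (N : AdmissibleNorms V) (n : ℕ) : AddCommGroup (N.Alg n) :=
  inferInstanceAs (AddCommGroup (⨂[ℝ]^n V))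

instance (N : AdmissibleNorms V) (n : ℕ) : Module ℝ (N.Alg n) :=
  inferInstanceAs (Module ℝ (⨂[ℝ]^n V))

instance (N : AdmissibleNorms V) (n : ℕ) : Norm (N.Alg n) := ⟨fun x => N.nrm n x⟩

theorem AdmissibleNorms.core (N : AdmissibleNorms V) (n : ℕ) :
    NormedSpace.Core ℝ (N.Alg n) where
  norm_nonneg x := apply_nonneg (N.nrm n) x
  norm_smul c x := map_smul_eq_mul (N.nrm n) c x
  norm_triangle x y := map_add_le_add (N.nrm n) x y
  norm_eq_zero_iff x := ⟨N.eq_zero_of_nrm n x, fun h => by rw [h]; exact map_zero (N.nrm n)⟩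

instance (N : AdmissibleNorms V) (n : ℕ) : NormedAddCommGroup (N.Alg n) :=
  NormedAddCommGroup.ofCore (N.core n)

instance (N : AdmissibleNorms V) (n : ℕ) : NormedSpace ℝ (N.Alg n) :=
  NormedSpace.ofCore (N.core n)

/-- The Banach space `V^{⊗n}`: the completion of the algebraic tensor power in the chosen
admissible norm. -/
abbrev AdmissibleNorms.Pow (N : AdmissibleNorms V) (n : ℕ) : Type _ :=
  UniformSpace.Completion (N.Alg n)

/-- The tensor product of algebraic tensors of degrees `i` and `j`, in degree `k = i + j`. -/
def AdmissibleNorms.algMul (N : AdmissibleNorms V) {i j k : ℕ} (h : i + j = k) :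
    N.Alg i →ₗ[ℝ] N.Alg j →ₗ[ℝ] N.Alg k :=
  (TensorProduct.mk ℝ (⨂[ℝ]^i V) (⨂[ℝ]^j V)).compr₂
    ((TensorPower.mulEquiv (R := ℝ) (M := V) (n := i) (m := j)).trans
      (TensorPower.cast ℝ V h)).toLinearMap

theorem AdmissibleNorms.norm_algMul_le (N : AdmissibleNorms V) {i j k : ℕ} (h : i + j = k)
    (x : N.Alg i) (y : N.Alg j) : ‖N.algMul h x y‖ ≤ ‖x‖ * ‖y‖ := by
  subst h
  have e : N.algMul rfl x y = GradedMonoid.GMul.mul (A := fun n => ⨂[ℝ]^n V) x y := by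
    change TensorPower.cast ℝ V rfl (TensorPower.mulEquiv (R := ℝ) (M := V) (x ⊗ₜ y)) = _
    rw [TensorPower.cast_refl]
    rfl
  rw [e]
  exact N.nrm_mul_le i j x y

/-- The tensor product of algebraic tensors, as a bounded bilinear map into the completion. -/
def AdmissibleNorms.preMul (N : AdmissibleNorms V) {i j k : ℕ} (h : i + j = k) :
    N.Alg i →L[ℝ] N.Alg j →L[ℝ] N.Pow k :=
  LinearMap.mkContinuous₂
    ((N.algMul h).compr₂ (UniformSpace.Completion.toComplL (𝕜 := ℝ) (E := N.Alg k)).toLinearMap) 1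
    (fun x y => by simpa using N.norm_algMul_le h x y)

/-- The tensor product `V^{⊗i} × V^{⊗j} → V^{⊗k}`, `k = i + j`: the continuous bilinear extension
of the algebraic one. -/
def AdmissibleNorms.mul (N : AdmissibleNorms V) {i j k : ℕ} (h : i + j = k) :
    N.Pow i →L[ℝ] N.Pow j →L[ℝ] N.Pow k :=
  (((N.preMul h).extend UniformSpace.Completion.toComplL).flip.extend
    UniformSpace.Completion.toComplL).flip

theorem AdmissibleNorms.mul_coe (N : AdmissibleNorms V) {i j k : ℕ} (h : i + j = k)
    (x : N.Alg i) (y : N.Alg j) :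
    N.mul h (x : N.Pow i) (y : N.Pow j) = ((N.algMul h x y : N.Alg k) : N.Pow k) := by
  have d : ∀ n, DenseRange (UniformSpace.Completion.toComplL (𝕜 := ℝ) (E := N.Alg n)) :=
    fun _ => UniformSpace.Completion.denseRange_coe
  have u : ∀ n, IsUniformInducing (UniformSpace.Completion.toComplL (𝕜 := ℝ) (E := N.Alg n)) :=
    fun _ => UniformSpace.Completion.isUniformInducing_coe _
  have e1 := ContinuousLinearMap.extend_eq
    ((N.preMul h).extend UniformSpace.Completion.toComplL).flip (d j) (u j) y
  have e2 := ContinuousLinearMap.extend_eq (N.preMul h) (d i) (u i) x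
  have e3 := congrArg (fun f => f (x : N.Pow i)) e1
  have e4 := congrArg (fun f => f y) e2
  exact e3.trans e4

/-! ### The truncated tensor algebra -/

/-- The truncated tensor algebra `T^{(n)}(V) = ℝ ⊕ V ⊕ ⋯ ⊕ V^{⊗n}`. -/
abbrev Trunc (N : AdmissibleNorms V) (n : ℕ) : Type _ := (i : Fin (n + 1)) → N.Pow i

/-- The scalar `1` in `V^{⊗0} = ℝ`. -/
def scalarOne (N : AdmissibleNorms V) : N.Pow 0 :=
  let e : N.Alg 0 := TensorPower.algebraMap₀ (R := ℝ) (M := V) 1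
  (e : N.Pow 0)

/-- The unit `(1, 0, …, 0)` of `T^{(n)}(V)`. -/
def unit (N : AdmissibleNorms V) (n : ℕ) : Trunc N n :=
  Fin.cons (α := fun i : Fin (n + 1) => N.Pow i) (scalarOne N) (fun _ => 0)

/-- The product of `T^{(n)}(V)`: `(a ⊗ b)^k = ∑_{i + j = k} a^i ⊗ b^j`. -/
def tmul {N : AdmissibleNorms V} {n : ℕ} (a b : Trunc N n) : Trunc N n := fun k =>
  ∑ i : Fin ((k : ℕ) + 1),
    N.mul (Nat.add_sub_cancel' (Nat.lt_succ_iff.mp i.2) : (i : ℕ) + ((k : ℕ) - i) = k)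
      (a ⟨i, lt_of_lt_of_le i.2 k.2⟩)
      (b ⟨(k : ℕ) - i, lt_of_le_of_lt (Nat.sub_le _ _) k.2⟩)

/-! ### Controls and functionals on the simplex -/

/-- The simplex `△_J = {(s, t) ∈ J² | s ≤ t}` over `J = [S, T]`. -/
abbrev Simplex (S T : ℝ) : Type := {q : Set.Icc S T × Set.Icc S T // q.1 ≤ q.2}

/-- The point `(s, t)` of the simplex. -/
abbrev pt {S T : ℝ} {s t : Set.Icc S T} (h : s ≤ t) : Simplex S T := ⟨(s, t), h⟩

/-- Controls on `J = [S, T]`: continuous, non-negative, super-additive functions on the simplex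
which vanish on the diagonal. -/
structure Control (S T : ℝ) where
  toFun : Simplex S T → ℝ
  continuous_toFun : Continuous toFun
  nonneg : ∀ q, 0 ≤ toFun q
  superadditive : ∀ (s u t : Set.Icc S T) (hsu : s ≤ u) (hut : u ≤ t),
    toFun (pt hsu) + toFun (pt hut) ≤ toFun (pt (hsu.trans hut))
  diagonal : ∀ t : Set.Icc S T, toFun (pt (le_refl t)) = 0

instance (S T : ℝ) : CoeFun (Control S T) (fun _ => Simplex S T → ℝ) := ⟨Control.toFun⟩

/-- Functionals `△_J → T^{(n)}(V)`, with pointwise operations. -/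
abbrev Functional (N : AdmissibleNorms V) (S T : ℝ) (n : ℕ) : Type _ := Simplex S T → Trunc N n

variable {N : AdmissibleNorms V} {S T : ℝ} {n : ℕ}

/-- The constant functional `𝟙 = (1, 0, …, 0)`. -/
def one (N : AdmissibleNorms V) (S T : ℝ) (n : ℕ) : Functional N S T n := fun _ => unit N n

/-- The truncation `(X^0, …, X^m)` of a functional of degree `n ≥ m`. -/
def trunc {m : ℕ} (h : m ≤ n) (X : Functional N S T n) : Functional N S T m :=
  fun q i => X q (Fin.castLE (Nat.succ_le_succ h) i)

/-- The functional `(X^0, …, X^n, ψ)` of degree `n + 1`. -/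
def append (X : Functional N S T n) (ψ : Simplex S T → N.Pow (n + 1)) :
    Functional N S T (n + 1) :=
  fun q => Fin.snoc (α := fun i : Fin (n + 2) => N.Pow i) (X q) (ψ q)

/-- The top level `X^n` of a functional of degree `n`. -/
def top (X : Functional N S T n) : Simplex S T → N.Pow n := fun q => X q (Fin.last n)

/-- Multiplicative functionals of degree `n`. -/
def IsMultiplicative (X : Functional N S T n) : Prop :=
  Continuous X ∧ (∀ q, X q 0 = scalarOne N) ∧
    ∀ (s u t : Set.Icc S T) (hsu : s ≤ u) (hut : u ≤ t),
      tmul (X (pt hsu)) (X (pt hut)) = X (pt (hsu.trans hut))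

/-- `β(p) = p (1 + ∑_{r ≥ 3} (2 / (r - 2))^{(⌊p⌋ + 1) / p})`. -/
def beta (p : ℝ) : ℝ :=
  p * (1 + ∑' r : ℕ, (2 / ((r : ℝ) + 1)) ^ (((⌊p⌋₊ : ℝ) + 1) / p))

/-- `X` has finite `p`-variation controlled by `ω` with constant `K`. -/
def HasPVariation (p : ℝ) (ω : Control S T) (K : ℝ) (X : Functional N S T n) : Prop :=
  ∀ (i : Fin (n + 1)), 1 ≤ (i : ℕ) → ∀ q : Simplex S T,
    ‖X q i‖ ≤ K * (ω q ^ ((i : ℝ) / p) / (beta p * Real.Gamma ((i : ℝ) / p + 1)))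

variable (N S T) in
/-- `Ω^{(n,p)}_ω(V)`. -/
def OmegaC (n : ℕ) (p : ℝ) (ω : Control S T) : Set (Functional N S T n) :=
  {X | ∃ K : ℝ, 0 ≤ K ∧ IsMultiplicative X ∧ HasPVariation p ω K X}

variable (N S T) in
/-- `Ω^{(n,p)}(V)`: multiplicative functionals of degree `n` and finite `p`-variation. -/
def Omega (n : ℕ) (p : ℝ) : Set (Functional N S T n) :=
  {X | ∃ ω : Control S T, X ∈ OmegaC N S T n p ω}

/-! ### Almost multiplicative functionals and sewing -/

variable (N S T) in
/-- `Ω^{am,(n,p)}_{θ,ω}(V)`: `θ`-almost multiplicative functionals of degree `n` and of finite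
`p`-variation, controlled by `ω`. -/
def OmegaAm (n : ℕ) (p θ : ℝ) (ω : Control S T) : Set (Functional N S T n) :=
  {X | ∃ K : ℝ, 0 ≤ K ∧ (∀ q, X q 0 = scalarOne N) ∧
    (∀ (s u t : Set.Icc S T) (hsu : s ≤ u) (hut : u ≤ t) (i : Fin (n + 1)), 1 ≤ (i : ℕ) →
      ‖tmul (X (pt hsu)) (X (pt hut)) i - X (pt (hsu.trans hut)) i‖
        ≤ K * ω (pt (hsu.trans hut)) ^ θ) ∧
    HasPVariation p ω K X}

/-- `Y` is a multiplicative functional of finite `p`-variation which is `ω^θ`-close to `X`. -/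
def IsSewing (p θ : ℝ) (ω : Control S T) (X Y : Functional N S T n) : Prop :=
  Y ∈ Omega N S T n p ∧
    ∃ K : ℝ, ∀ (i : Fin (n + 1)), 1 ≤ (i : ℕ) → ∀ q : Simplex S T,
      ‖Y q i - X q i‖ ≤ K * ω q ^ θ

/-- The sewing map `𝒮`: the multiplicative functional associated with an almost multiplicative
functional `X`, for any admissible parameters `p, θ, ω`. -/
def sewing (X : Functional N S T n) : Functional N S T n :=
  Classical.epsilon fun Y => ∃ (p θ : ℝ) (ω : Control S T), 1 ≤ p ∧ 1 < θ ∧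
    X ∈ OmegaAm N S T n p θ ω ∧ IsSewing p θ ω X Y

/-- `𝒮(X)` is well defined: `X` is almost multiplicative of finite `p`-variation, and, for all
admissible parameters, `𝒮(X)` is the one and only functional associated with `X`. -/
def SewingWellDefined (p : ℝ) (X : Functional N S T n) : Prop :=
  (∃ (θ : ℝ) (ω : Control S T), 1 < θ ∧ X ∈ OmegaAm N S T n p θ ω) ∧
  ∀ (r θ : ℝ) (ω : Control S T), 1 ≤ r → 1 < θ → X ∈ OmegaAm N S T n r θ ω →
    ∀ Y : Functional N S T n, IsSewing r θ ω X Y ↔ Y = sewing X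

/-! ### One-step extension -/

/-- `Y` extends `X` to a multiplicative functional of degree `n + 1` and finite `r`-variation. -/
def IsExt (r : ℝ) (X : Functional N S T n) (Y : Functional N S T (n + 1)) : Prop :=
  Y ∈ Omega N S T (n + 1) r ∧ trunc (Nat.le_succ n) Y = X

/-- The extension map `Ext_n : ⋃_{1 ≤ r < n+1} Ω^{(n,r)}(V) → ⋃_{1 ≤ r < n+1} Ω^{(n+1,r)}(V)`. -/
def ext (X : Functional N S T n) : Functional N S T (n + 1) :=
  Classical.epsilon fun Y => ∃ r : ℝ, 1 ≤ r ∧ r < (n : ℝ) + 1 ∧ IsExt r X Y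

/-- `Ext_n(X)` is well defined: `X` has finite `r`-variation for some `r ∈ [1, n + 1)`, and, for
all such `r`, `Ext_n(X)` is the one and only extension of `X` of finite `r`-variation. -/
def ExtWellDefined (X : Functional N S T n) : Prop :=
  (∃ r : ℝ, 1 ≤ r ∧ r < (n : ℝ) + 1 ∧ X ∈ Omega N S T n r) ∧
  ∀ r : ℝ, 1 ≤ r → r < (n : ℝ) + 1 → X ∈ Omega N S T n r →
    ∀ Y : Functional N S T (n + 1), IsExt r X Y ↔ Y = ext X

/-! ### The spaces `𝓗^p(V)` and `𝔍^p(V)` -/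

variable (N S T) in
/-- `𝓗^{(n,p)}(V)`. -/
def HSpaceK (n : ℕ) (p : ℝ) : Set (Functional N S T n) :=
  {H | H ∈ Omega N S T n p ∧ ∃ (K : ℝ) (ω : Control S T) (φ : ℝ), 0 ≤ K ∧
    φ ∈ Set.Ioc (1 - 1 / p) 1 ∧
    ∀ (i : Fin (n + 1)), 1 ≤ (i : ℕ) → ∀ q : Simplex S T, ‖H q i‖ ≤ K * ω q ^ φ}

variable (N S T) in
/-- `𝓗^p(V) = 𝓗^{(⌊p⌋,p)}(V)`. -/
def HSpace (p : ℝ) : Set (Functional N S T ⌊p⌋₊) := HSpaceK N S T ⌊p⌋₊ p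

/-- Additive functionals. -/
def IsAdditive (I : Functional N S T n) : Prop :=
  ∀ (s u t : Set.Icc S T) (hsu : s ≤ u) (hut : u ≤ t),
    I (pt hsu) + I (pt hut) = I (pt (hsu.trans hut))

variable (N S T) in
/-- `𝔍^{(n,p)}(V)`. -/
def ISpaceK (n : ℕ) (p : ℝ) : Set (Functional N S T n) :=
  {I | (∀ q, I q 0 = 0) ∧ IsAdditive I ∧ ∃ (K : ℝ) (ω : Control S T) (φ : ℝ), 0 ≤ K ∧
    φ ∈ Set.Ioc (1 - 1 / p) 1 ∧
    (∀ (i : Fin (n + 1)), 1 ≤ (i : ℕ) → ∀ q : Simplex S T, ‖I q i‖ ≤ K * ω q ^ φ) ∧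
    (n = ⌊p⌋₊ → ∀ q : Simplex S T, ‖top I q‖ ≤ K * ω q ^ ((n : ℝ) / p))}

variable (N S T) in
/-- `𝔍^p(V) = 𝔍^{(⌊p⌋,p)}(V)`. -/
def ISpace (p : ℝ) : Set (Functional N S T ⌊p⌋₊) := ISpaceK N S T ⌊p⌋₊ p

/-! ### Development, lift, and the operations -/

/-- The development map
`dev(H) = (0, H^1, H^2 - Ext_1(1, H^1)^2, …, H^n - Ext_{n-1}(1, …, H^{n-1})^n)`. -/
def dev : {n : ℕ} → Functional N S T n → Functional N S T n
  | 0, _ => 0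
  | 1, H => append 0 (top H)
  | m + 2, H => append (dev (trunc (Nat.le_succ (m + 1)) H))
      (top H - top (ext (trunc (Nat.le_succ (m + 1)) H)))

/-- The lift map: `𝟙^{(0, I^1)} = (1, I^1)` and
`𝟙^I = Ext_{n-1}(𝟙^{(0, I^1, …, I^{n-1})}) + (0, …, 0, I^n)`. -/
def lift : {n : ℕ} → Functional N S T n → Functional N S T n
  | 0, _ => one N S T 0
  | 1, I => append (one N S T 0) (top I)
  | m + 2, I => ext (lift (trunc (Nat.le_succ (m + 1)) I)) + append 0 (top I)

/-- The unit-preserving pointwise sum `X ⊕ H = X + H - 𝟙`. -/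
def oplus (X H : Functional N S T n) : Functional N S T n := X + H - one N S T n

/-- `X ⊞ H = 𝒮(X ⊕ H)`. -/
def boxplus (X H : Functional N S T n) : Functional N S T n := sewing (oplus X H)

/-- `a ⊙ H = 𝟙^{a dev(H)}`. -/
def odot (a : ℝ) (H : Functional N S T n) : Functional N S T n := lift (a • dev H)

end RoughPath

end

noncomputable section

namespace RoughPath

variable {V : Type*} [NormedAddCommGroup V] [NormedSpace ℝ V]

/-! ### Algebra of the truncated tensor algebra -/

/-! Everything is solved one degree at a time. If `a` and `b` have scalar part 1, the degree `n + 1`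
part of `a ⊗ b` is `a^{n+1} + b^{n+1} + cross a b`, where `cross` sees only degrees `1, …, n`
(`lastComp_tmul`). So, over a fixed functional satisfying Chen's identity up to degree `n`, the next
level solves an affine equation, and two solutions differ by an additive function of intervals. An
additive function that is `O(ω^θ)` with `θ > 1` vanishes (`eq_of_sub_le_control_rpow`); this gives
uniqueness. Existence is Young's argument for almost additive functions (`exists_additive_near`),
applied after associativity, in the form of `cross_cocycle`, has absorbed the cross term
(`exists_chen_append`). Induction on the degree then yields extensions and sewings, and uniqueness
makes their definition by choice harmless. For `𝓗^p` the decisive point is arithmetic of exponents.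
If the levels up to `n < ⌊p⌋` are `O(ω^φ)` with `φ > 1 - 1/p`, then `pφ > p - 1 ≥ n`, and the level
added by the extension is `O(ω^{φ + 1/p})`, with exponent above 1 (`ext_of_levelControlled`). Adding
it to an additive level, or subtracting it from a level of `H`, leaves the growth conditions intact,
so lift and development are mutually inverse (`lift_spec`, `dev_spec`). The same estimate says that
a lift agrees with its additive data in positive degrees up to `O(ω^{φ + 1/p})`. Hence the lift of
`I + J` is that close to the pointwise sum of the two lifts, and by uniqueness it is the sewing of
that sum (`boxplus_spec`). Thus `⊞` and `⊙` are the pointwise operations of `𝔍^p` transported along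
the bijection, and the vector space axioms come for free. -/

theorem AdmissibleNorms.norm_mul_le (N : AdmissibleNorms V) {i j k : ℕ} (h : i + j = k)
    (x : N.Pow i) (y : N.Pow j) : ‖N.mul h x y‖ ≤ ‖x‖ * ‖y‖ := by
  induction x, y using UniformSpace.Completion.induction_on₂ with
  | hp =>
    refine isClosed_le ?_ (by fun_prop)
    exact ((N.mul h).continuous₂).norm
  | ih x y =>
    rw [N.mul_coe, UniformSpace.Completion.norm_coe, UniformSpace.Completion.norm_coe,
      UniformSpace.Completion.norm_coe]
    exact N.norm_algMul_le h x y

theorem AdmissibleNorms.algMul_assoc (N : AdmissibleNorms V) {i j k l l' m : ℕ} (h₁ : i + j = l)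
    (h₂ : l + k = m) (h₃ : j + k = l') (h₄ : i + l' = m) (x : N.Alg i) (y : N.Alg j)
    (z : N.Alg k) : N.algMul h₂ (N.algMul h₁ x y) z = N.algMul h₄ x (N.algMul h₃ y z) := by
  have key : ∀ (x : ⨂[ℝ]^i V) (y : ⨂[ℝ]^j V) (z : ⨂[ℝ]^k V),
      TensorPower.cast ℝ V h₂ (GradedMonoid.GMul.mul (A := fun n => ⨂[ℝ]^n V)
        (TensorPower.cast ℝ V h₁ (GradedMonoid.GMul.mul (A := fun n => ⨂[ℝ]^n V) x y)) z) =
      TensorPower.cast ℝ V h₄ (GradedMonoid.GMul.mul (A := fun n => ⨂[ℝ]^n V) x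
        (TensorPower.cast ℝ V h₃ (GradedMonoid.GMul.mul (A := fun n => ⨂[ℝ]^n V) y z))) := by
    intro x y z
    subst h₁ h₃ h₂
    simp only [TensorPower.cast_refl, LinearEquiv.refl_apply]
    rw [← TensorPower.mul_assoc (R := ℝ) (M := V) x y z, TensorPower.cast_cast,
      TensorPower.cast_refl, LinearEquiv.refl_apply]
  exact key x y z

theorem AdmissibleNorms.mul_assoc (N : AdmissibleNorms V) {i j k l l' m : ℕ} (h₁ : i + j = l)
    (h₂ : l + k = m) (h₃ : j + k = l') (h₄ : i + l' = m) (x : N.Pow i) (y : N.Pow j)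
    (z : N.Pow k) : N.mul h₂ (N.mul h₁ x y) z = N.mul h₄ x (N.mul h₃ y z) := by
  induction x, y, z using UniformSpace.Completion.induction_on₃ with
  | hp =>
    refine isClosed_eq ?_ ?_
    · exact (N.mul h₂).continuous₂.comp (((N.mul h₁).continuous₂.comp
        (by fun_prop : Continuous fun p : N.Pow i × N.Pow j × N.Pow k => (p.1, p.2.1))).prodMk
        (by fun_prop : Continuous fun p : N.Pow i × N.Pow j × N.Pow k => p.2.2))
    · exact (N.mul h₄).continuous₂.comp ((by fun_prop :
        Continuous fun p : N.Pow i × N.Pow j × N.Pow k => p.1).prodMk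
        ((N.mul h₃).continuous₂.comp
        (by fun_prop : Continuous fun p : N.Pow i × N.Pow j × N.Pow k => p.2)))
  | ih x y z => simp only [N.mul_coe, N.algMul_assoc h₁ h₂ h₃ h₄]

theorem AdmissibleNorms.scalarOne_mul (N : AdmissibleNorms V) {k : ℕ} (h : 0 + k = k)
    (x : N.Pow k) : N.mul h (scalarOne N) x = x := by
  induction x using UniformSpace.Completion.induction_on with
  | hp => exact isClosed_eq (by fun_prop) continuous_id
  | ih x =>
    refine (N.mul_coe h _ x).trans (congrArg _ ?_)
    refine (TensorPower.algebraMap₀_mul (R := ℝ) (M := V) 1 x).trans (one_smul _ _)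

theorem AdmissibleNorms.mul_scalarOne (N : AdmissibleNorms V) {k : ℕ} (h : k + 0 = k)
    (x : N.Pow k) : N.mul h x (scalarOne N) = x := by
  induction x using UniformSpace.Completion.induction_on with
  | hp => exact isClosed_eq ((N.mul h).flip (scalarOne N)).continuous continuous_id
  | ih x =>
    refine (N.mul_coe h x _).trans (congrArg _ ?_)
    refine (TensorPower.mul_algebraMap₀ (R := ℝ) (M := V) 1 x).trans (one_smul _ _)

/-! ### Associativity of the truncated product -/

/-- The tensor product into degree `k`, extended by zero to all pairs of degrees. -/
def AdmissibleNorms.mulOrZero (N : AdmissibleNorms V) (i j k : ℕ) :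
    N.Pow i →L[ℝ] N.Pow j →L[ℝ] N.Pow k :=
  if h : i + j = k then N.mul h else 0

theorem AdmissibleNorms.mulOrZero_of_ne (N : AdmissibleNorms V) {i j k : ℕ} (h : i + j ≠ k) :
    N.mulOrZero i j k = 0 :=
  dif_neg h

theorem AdmissibleNorms.mulOrZero_of_eq (N : AdmissibleNorms V) {i j k : ℕ} (h : i + j = k) :
    N.mulOrZero i j k = N.mul h :=
  dif_pos h

variable {N : AdmissibleNorms V} {n : ℕ}

/-- Summing over all pairs of degrees, with zeros where the degrees do not match, removes the
dependence of the summation range on `k`; associativity then reduces to exchanging sums. -/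
theorem tmul_apply (a b : Trunc N n) (k : Fin (n + 1)) :
    tmul a b k = ∑ i : Fin (n + 1), ∑ j : Fin (n + 1), N.mulOrZero i j k (a i) (b j) := by
  have hk : (k : ℕ) < n + 1 := k.2
  let f : ℕ → N.Pow k := fun i => if h : i ≤ k then
    N.mul (Nat.add_sub_cancel' h) (a ⟨i, by omega⟩) (b ⟨k - i, by omega⟩) else 0
  have e₁ : tmul a b k = ∑ i : Fin ((k : ℕ) + 1), f i := by
    refine Finset.sum_congr rfl fun i _ => ?_
    simp only [f]
    rw [dif_pos (Nat.lt_succ_iff.mp i.2)]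
  have e₂ : ∀ i : Fin (n + 1), ∑ j : Fin (n + 1), N.mulOrZero i j k (a i) (b j) = f i := by
    intro i
    by_cases h : (i : ℕ) ≤ k
    · rw [Finset.sum_eq_single (⟨k - i, by omega⟩ : Fin (n + 1))]
      · rw [N.mulOrZero_of_eq (Nat.add_sub_cancel' h)]
        simp only [f]
        rw [dif_pos h]
      · intro j _ hj
        rw [N.mulOrZero_of_ne]
        · rfl
        · intro h'
          exact hj (Fin.ext (by simp only; omega))
      · simp
    · rw [Finset.sum_eq_zero]
      · simp only [f]
        rw [dif_neg h]
      · intro j _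
        rw [N.mulOrZero_of_ne (by omega)]
        rfl
  rw [e₁, Finset.sum_congr rfl fun i _ => e₂ i, Fin.sum_univ_eq_sum_range f,
    Fin.sum_univ_eq_sum_range f]
  refine Finset.sum_subset (Finset.range_mono (by omega)) fun i _ hi => ?_
  exact dif_neg (by simpa [Nat.lt_succ_iff] using hi)

/-- Only the intermediate degree `i + j` on the left and `j + l` on the right can contribute; when
`i + j + l ≠ k` both sides vanish. -/
theorem mulOrZero_mulOrZero_assoc (k i j l : Fin (n + 1)) (x : N.Pow i) (y : N.Pow j)
    (z : N.Pow l) :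
    ∑ m : Fin (n + 1), N.mulOrZero m l k (N.mulOrZero i j m x y) z =
      ∑ m : Fin (n + 1), N.mulOrZero i m k x (N.mulOrZero j l m y z) := by
  have hk : (k : ℕ) < n + 1 := k.2
  by_cases h : (i : ℕ) + j + l = k
  · rw [Finset.sum_eq_single (⟨i + j, by omega⟩ : Fin (n + 1)),
      Finset.sum_eq_single (⟨j + l, by omega⟩ : Fin (n + 1))]
    · rw [N.mulOrZero_of_eq (show (i : ℕ) + j = (⟨i + j, by omega⟩ : Fin (n + 1)) from rfl),
        N.mulOrZero_of_eq (show (j : ℕ) + l = (⟨j + l, by omega⟩ : Fin (n + 1)) from rfl),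
        N.mulOrZero_of_eq (by simpa using h), N.mulOrZero_of_eq (by simp only; omega)]
      exact N.mul_assoc _ _ _ _ x y z
    · intro m _ hm
      rw [N.mulOrZero_of_ne (i := j) fun h' => hm (Fin.ext h'.symm)]
      simp
    · simp
    · intro m _ hm
      rw [N.mulOrZero_of_ne (i := i) fun h' => hm (Fin.ext h'.symm)]
      simp
    · simp
  · rw [Finset.sum_eq_zero, Finset.sum_eq_zero]
    · intro m _
      by_cases hm : (j : ℕ) + l = m
      · rw [N.mulOrZero_of_ne (i := i) (by omega)]
        simp
      · rw [N.mulOrZero_of_ne hm]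
        simp
    · intro m _
      by_cases hm : (i : ℕ) + j = m
      · rw [N.mulOrZero_of_ne (j := l) (by omega)]
        simp
      · rw [N.mulOrZero_of_ne hm]
        simp

theorem tmul_assoc (a b c : Trunc N n) : tmul (tmul a b) c = tmul a (tmul b c) := by
  funext k
  have e₁ : tmul (tmul a b) c k = ∑ i : Fin (n + 1), ∑ j : Fin (n + 1), ∑ l : Fin (n + 1),
      ∑ m : Fin (n + 1), N.mulOrZero m l k (N.mulOrZero i j m (a i) (b j)) (c l) := by
    rw [tmul_apply]
    simp only [tmul_apply a b, map_sum, FunLike.coe_sum, Finset.sum_apply]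
    rw [Finset.sum_comm]
    rw [Finset.sum_congr rfl fun l _ => Finset.sum_comm]
    rw [Finset.sum_comm]
    refine Finset.sum_congr rfl fun i _ => ?_
    rw [Finset.sum_congr rfl fun l _ => Finset.sum_comm]
    rw [Finset.sum_comm]
  have e₂ : tmul a (tmul b c) k = ∑ i : Fin (n + 1), ∑ j : Fin (n + 1), ∑ l : Fin (n + 1),
      ∑ m : Fin (n + 1), N.mulOrZero i m k (a i) (N.mulOrZero j l m (b j) (c l)) := by
    rw [tmul_apply]
    simp only [tmul_apply b c, map_sum]
    refine Finset.sum_congr rfl fun i _ => ?_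
    rw [Finset.sum_comm]
    refine Finset.sum_congr rfl fun j _ => ?_
    rw [Finset.sum_comm]
  rw [e₁, e₂]
  simp only [mulOrZero_mulOrZero_assoc]

theorem tmul_zero_apply {a b : Trunc N n} (ha : a 0 = scalarOne N) (hb : b 0 = scalarOne N) :
    tmul a b 0 = scalarOne N := by
  have e : tmul a b 0 = N.mul (Nat.add_zero 0) (a 0) (b 0) := Fin.sum_univ_one _
  rw [e, ha, hb]
  exact N.scalarOne_mul _ _

/-! ### The product in its highest degree -/

/-- The part `∑_{0 < i < n + 1} a^i ⊗ b^{n + 1 - i}` of the product in degree `n + 1` that only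
involves degrees up to `n`. -/
def cross (a b : Trunc N n) : N.Pow (n + 1) :=
  ∑ i : Fin n, N.mul (by omega : ((i : ℕ) + 1) + (n + 1 - ((i : ℕ) + 1)) = n + 1)
    (a ⟨i + 1, by omega⟩) (b ⟨n + 1 - ((i : ℕ) + 1), by omega⟩)

/-- The component of highest degree. -/
def lastComp (a : Trunc N n) : N.Pow n := a (Fin.last n)

/-- The components of degree up to `n`. -/
def initComp (a : Trunc N (n + 1)) : Trunc N n := fun i => a i.castSucc

/-- The element `(a^0, …, a^n, x)`. -/
def snocComp (a : Trunc N n) (x : N.Pow (n + 1)) : Trunc N (n + 1) :=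
  Fin.snoc (α := fun i : Fin (n + 2) => N.Pow i) a x

@[simp]
theorem lastComp_snocComp (a : Trunc N n) (x : N.Pow (n + 1)) : lastComp (snocComp a x) = x :=
  Fin.snoc_last (α := fun i : Fin (n + 2) => N.Pow i) x a

@[simp]
theorem initComp_snocComp (a : Trunc N n) (x : N.Pow (n + 1)) : initComp (snocComp a x) = a :=
  funext fun i => Fin.snoc_castSucc (α := fun i : Fin (n + 2) => N.Pow i) x a i

theorem initComp_tmul (a b : Trunc N (n + 1)) :
    initComp (tmul a b) = tmul (initComp a) (initComp b) :=
  rfl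

theorem ext_initComp_lastComp {a b : Trunc N (n + 1)} (h : initComp a = initComp b)
    (h' : lastComp a = lastComp b) : a = b :=
  funext fun i => Fin.lastCases (motive := fun i => a i = b i) h' (fun i => congrFun h i) i

/-- The two extreme terms of the convolution contain a scalar part equal to 1 and reproduce the top
components; the remaining terms are `cross`. -/
theorem lastComp_tmul {a b : Trunc N (n + 1)} (ha : a 0 = scalarOne N) (hb : b 0 = scalarOne N) :
    lastComp (tmul a b) = lastComp a + lastComp b + cross (initComp a) (initComp b) := by
  have h₀ : ∀ (j : ℕ) (hj : j < n + 2) (h : n + 1 + j = n + 1),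
      N.mul h (lastComp a) (b ⟨j, hj⟩) = lastComp a := by
    intro j hj h
    obtain rfl : j = 0 := by omega
    have e : b ⟨0, hj⟩ = scalarOne N := hb
    exact (congrArg _ e).trans (N.mul_scalarOne h _)
  have h₁ : ∀ h : 0 + (n + 1) = n + 1, N.mul h (a 0) (lastComp b) = lastComp b := by
    intro h
    rw [ha]
    exact N.scalarOne_mul h _
  refine (Fin.sum_univ_castSucc (n := n + 1) _).trans ?_
  have e : ∀ x y z : N.Pow (n + 1), x + y + z = z + x + y := fun x y z => by abel
  refine (congrArg₂ (· + ·) (Fin.sum_univ_succ _) rfl).trans (Eq.trans ?_ (e _ _ _))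
  exact congrArg₂ _ (congrArg₂ _ (h₁ _) rfl) (h₀ _ _ _)

/-- This is associativity in degree `n + 1`, read off after padding the three elements with a zero
top component. -/
theorem cross_cocycle {a b c : Trunc N n} (ha : a 0 = scalarOne N) (hb : b 0 = scalarOne N)
    (hc : c 0 = scalarOne N) :
    cross a b + cross (tmul a b) c = cross b c + cross a (tmul b c) := by
  have h₀ : ∀ x : Trunc N n, x 0 = scalarOne N → snocComp x 0 0 = scalarOne N := by
    intro x hx
    rw [← hx]
    exact congrFun (initComp_snocComp x 0) 0
  have h := congrArg lastComp (tmul_assoc (snocComp a 0) (snocComp b 0) (snocComp c 0))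
  rw [lastComp_tmul (tmul_zero_apply (h₀ a ha) (h₀ b hb)) (h₀ c hc),
    lastComp_tmul (h₀ a ha) (tmul_zero_apply (h₀ b hb) (h₀ c hc)),
    lastComp_tmul (h₀ a ha) (h₀ b hb), lastComp_tmul (h₀ b hb) (h₀ c hc)] at h
  simpa only [initComp_tmul, lastComp_snocComp, initComp_snocComp, add_zero, zero_add] using h

theorem norm_cross_le (a b : Trunc N n) :
    ‖cross a b‖ ≤ ∑ i : Fin n, ‖a ⟨i + 1, by omega⟩‖ * ‖b ⟨n + 1 - ((i : ℕ) + 1), by omega⟩‖ :=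
  norm_sum_le_of_le _ fun _ _ => N.norm_mul_le _ _ _

theorem cross_sub_cross (a b a' b' : Trunc N n) :
    cross a b - cross a' b' = cross (a - a') b + cross a' (b - b') := by
  simp only [cross, ← Finset.sum_sub_distrib, ← Finset.sum_add_distrib]
  refine Finset.sum_congr rfl fun i _ => ?_
  simp

theorem cross_add_right (a b b' : Trunc N n) : cross a (b + b') = cross a b + cross a b' := by
  simp [cross, ← Finset.sum_add_distrib]

theorem cross_add_left (a a' b : Trunc N n) : cross (a + a') b = cross a b + cross a' b := by
  simp [cross, ← Finset.sum_add_distrib]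

end RoughPath

namespace RoughPath

/-! ### The additive sewing lemma -/

section Maximal

variable {α E : Type*} [LinearOrder α] [NormedAddCommGroup E]

/-- Young's maximal inequality: the sum of an almost additive function along a partition is
close to its value, uniformly in the partition. -/
theorem norm_sum_sub_le_of_almost_additive {w : α → α → ℝ} {A : α → α → E} {K θ : ℝ}
    (hθ : 1 < θ) (hw : ∀ s t, 0 ≤ w s t) (hw₀ : ∀ s, w s s = 0)
    (hsup : ∀ s u t, s ≤ u → u ≤ t → w s u + w u t ≤ w s t) (hK : 0 ≤ K) (hA₀ : ∀ s, A s s = 0)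
    (hA : ∀ s u t, s ≤ u → u ≤ t → ‖A s u + A u t - A s t‖ ≤ K * w s t ^ θ)
    {x : ℕ → α} (hx : Monotone x) (d m : ℕ) :
    ‖∑ i ∈ Finset.Ico m (m + d), A (x i) (x (i + 1)) - A (x m) (x (m + d))‖ ≤
      2 * K / (1 - 2 ^ (1 - θ)) * w (x m) (x (m + d)) ^ θ := by
  -- The constant solves `C = 2^(1 - θ) C + 2 K`: two halves handled by recursion, plus two defects
  -- of additivity. It is finite and nonnegative because `θ > 1`.
  have h2 : (2 : ℝ) ^ (1 - θ) < 1 := Real.rpow_lt_one_of_one_lt_of_neg one_lt_two (by linarith)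
  set C : ℝ := 2 * K / (1 - 2 ^ (1 - θ)) with hC
  have hC0 : 0 ≤ C := div_nonneg (by positivity) (by linarith)
  have hCK : C * 2 ^ (1 - θ) + 2 * K = C := by
    have : C * (1 - 2 ^ (1 - θ)) = 2 * K := div_mul_cancel₀ _ (by linarith)
    linarith
  induction d using Nat.strong_induction_on generalizing m with
  | _ d ih =>
  rcases Nat.eq_zero_or_pos d with rfl | hd
  · simp only [add_zero, Finset.Ico_self, Finset.sum_empty, hA₀, sub_zero, norm_zero]
    exact mul_nonneg hC0 (Real.rpow_nonneg (hw _ _) _)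
  set W := w (x m) (x (m + d)) with hW
  have hW0 : 0 ≤ W := hw _ _
  classical
  -- Cut at the last point, short of the endpoint, where the control has used at most half of its
  -- total. By superadditivity the part after the next point also uses at most half; if `j = d - 1`,
  -- that part is empty.
  obtain ⟨j, hjd, hj, hj'⟩ : ∃ j < d, w (x m) (x (m + j)) ≤ W / 2 ∧
      w (x (m + j + 1)) (x (m + d)) ≤ W / 2 := by
    let P : ℕ → Prop := fun j => w (x m) (x (m + j)) ≤ W / 2
    have hP0 : P 0 := by simp only [P, add_zero, hw₀]; positivity
    refine ⟨Nat.findGreatest P (d - 1), ?_, Nat.findGreatest_spec (Nat.zero_le _) hP0, ?_⟩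
    · exact lt_of_le_of_lt (Nat.findGreatest_le _) (by omega)
    set j := Nat.findGreatest P (d - 1) with hj
    have hjd : j ≤ d - 1 := Nat.findGreatest_le _
    rcases eq_or_lt_of_le hjd with h | h
    · rw [show m + j + 1 = m + d by omega, hw₀]
      positivity
    · have hn : ¬ P (j + 1) := Nat.findGreatest_is_greatest (Nat.lt_succ_self j) (by omega)
      have := hsup (x m) (x (m + j + 1)) (x (m + d)) (hx (by omega)) (hx (by omega))
      simp only [P, not_le, ← add_assoc] at hn
      linarith
  have i₁ := ih j hjd m
  have i₂ := ih (d - (j + 1)) (by omega) (m + j + 1)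
  rw [show m + j + 1 + (d - (j + 1)) = m + d by omega] at i₂
  have hsplit : ∑ i ∈ Finset.Ico m (m + d), A (x i) (x (i + 1)) =
      ∑ i ∈ Finset.Ico m (m + j), A (x i) (x (i + 1)) + A (x (m + j)) (x (m + j + 1)) +
        ∑ i ∈ Finset.Ico (m + j + 1) (m + d), A (x i) (x (i + 1)) := by
    rw [← Finset.sum_Ico_succ_top (by omega), Finset.sum_Ico_consecutive _ (by omega) (by omega)]
  have j₁ := hA (x m) (x (m + j)) (x (m + j + 1)) (hx (by omega)) (hx (by omega))
  have j₂ := hA (x m) (x (m + j + 1)) (x (m + d)) (hx (by omega)) (hx (by omega))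
  have hmono : w (x m) (x (m + j + 1)) ≤ W := by
    have := hsup (x m) (x (m + j + 1)) (x (m + d)) (hx (by omega)) (hx (by omega))
    have := hw (x (m + j + 1)) (x (m + d))
    linarith
  have k₁ : w (x m) (x (m + j + 1)) ^ θ ≤ W ^ θ :=
    Real.rpow_le_rpow (hw _ _) hmono (by linarith)
  have k₂ : ∀ y, 0 ≤ y → y ≤ W / 2 → C * y ^ θ ≤ C * (2 ^ (1 - θ) * W ^ θ) / 2 := by
    intro y hy hy'
    have h₁ : y ^ θ ≤ (W / 2) ^ θ := Real.rpow_le_rpow hy hy' (by linarith)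
    have h₂ : (W / 2) ^ θ = 2 ^ (1 - θ) * W ^ θ / 2 := by
      rw [Real.div_rpow hW0 zero_le_two, Real.rpow_sub two_pos, Real.rpow_one]
      field_simp
    rw [h₂] at h₁
    calc C * y ^ θ ≤ C * (2 ^ (1 - θ) * W ^ θ / 2) := mul_le_mul_of_nonneg_left h₁ hC0
      _ = _ := by ring
  have l₁ := k₂ _ (hw _ _) hj
  have l₂ := k₂ _ (hw _ _) hj'
  rw [hsplit]
  set s₁ := ∑ i ∈ Finset.Ico m (m + j), A (x i) (x (i + 1))
  set s₂ := ∑ i ∈ Finset.Ico (m + j + 1) (m + d), A (x i) (x (i + 1))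
  -- The error splits into those of the two outer blocks and the defects from re-attaching first the
  -- middle interval and then the right block.
  have e : s₁ + A (x (m + j)) (x (m + j + 1)) + s₂ - A (x m) (x (m + d)) =
      (s₁ - A (x m) (x (m + j))) + (s₂ - A (x (m + j + 1)) (x (m + d))) +
      (A (x m) (x (m + j)) + A (x (m + j)) (x (m + j + 1)) - A (x m) (x (m + j + 1))) +
      (A (x m) (x (m + j + 1)) + A (x (m + j + 1)) (x (m + d)) - A (x m) (x (m + d))) := by
    abel
  rw [e]
  have n₁ : K * w (x m) (x (m + j + 1)) ^ θ ≤ K * W ^ θ := mul_le_mul_of_nonneg_left k₁ hK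
  have n₂ := (norm_add₄_le (a := s₁ - A (x m) (x (m + j)))
    (b := s₂ - A (x (m + j + 1)) (x (m + d)))
    (c := A (x m) (x (m + j)) + A (x (m + j)) (x (m + j + 1)) - A (x m) (x (m + j + 1)))
    (d := A (x m) (x (m + j + 1)) + A (x (m + j + 1)) (x (m + d)) - A (x m) (x (m + d))))
  have n₃ : C * W ^ θ = C * (2 ^ (1 - θ) * W ^ θ) + 2 * (K * W ^ θ) := by
    conv_lhs => rw [← hCK]
    ring
  linarith

end Maximal

variable {S T : ℝ}

/-! ### Controls and equidistant partitions -/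

/-- The value `ω(s, t)`, extended by zero to `s > t`. -/
def Control.val (ω : Control S T) (s t : Set.Icc S T) : ℝ :=
  if h : s ≤ t then ω (pt h) else 0

theorem Control.val_of_le (ω : Control S T) {s t : Set.Icc S T} (h : s ≤ t) :
    ω.val s t = ω (pt h) :=
  dif_pos h

theorem Control.val_nonneg (ω : Control S T) (s t : Set.Icc S T) : 0 ≤ ω.val s t := by
  unfold Control.val
  split_ifs
  · exact ω.nonneg _
  · exact le_rfl

theorem Control.val_self (ω : Control S T) (s : Set.Icc S T) : ω.val s s = 0 := by
  rw [ω.val_of_le le_rfl, ω.diagonal]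

theorem Control.val_superadditive (ω : Control S T) (s u t : Set.Icc S T) (hsu : s ≤ u)
    (hut : u ≤ t) : ω.val s u + ω.val u t ≤ ω.val s t := by
  rw [ω.val_of_le hsu, ω.val_of_le hut, ω.val_of_le (hsu.trans hut)]
  exact ω.superadditive s u t hsu hut

theorem Control.val_mono (ω : Control S T) {s s' t' t : Set.Icc S T} (h₁ : s ≤ s') (h₂ : s' ≤ t')
    (h₃ : t' ≤ t) : ω.val s' t' ≤ ω.val s t := by
  have a := ω.val_superadditive s s' t h₁ (h₂.trans h₃)
  have b := ω.val_superadditive s' t' t h₂ h₃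
  have c := ω.val_nonneg s s'
  have d := ω.val_nonneg t' t
  linarith

theorem Control.val_min_le (ω : Control S T) {a b : Set.Icc S T} (t : Set.Icc S T) (h : a ≤ b) :
    ω.val (min a t) (min b t) ≤ ω.val a b := by
  rcases le_total t a with h' | h'
  · rw [min_eq_right h', min_eq_right (h'.trans h), ω.val_self]
    exact ω.val_nonneg _ _
  · rw [min_eq_left h']
    exact ω.val_mono le_rfl (le_min h h') (min_le_left _ _)

instance compactSpace_simplex : CompactSpace (Simplex S T) :=
  isCompact_iff_compactSpace.mp
    (isClosed_le continuous_fst continuous_snd :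
      IsClosed {q : Set.Icc S T × Set.Icc S T | q.1 ≤ q.2}).isCompact

/-- A control is uniformly continuous on the compact simplex and vanishes on the diagonal. -/
theorem exists_control_lt_of_sub_lt (ω : Control S T) {ε : ℝ} (hε : 0 < ε) :
    ∃ δ > 0, ∀ s t : Set.Icc S T, s ≤ t → (t : ℝ) - s < δ → ω.val s t < ε := by
  have hu := CompactSpace.uniformContinuous_of_continuous ω.continuous_toFun
  obtain ⟨δ, hδ, h⟩ := Metric.uniformContinuous_iff.mp hu ε hε
  refine ⟨δ, hδ, fun s t hst hlt => ?_⟩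
  have hd : dist (pt hst) (pt (le_refl s)) < δ := by
    rw [Subtype.dist_eq, Prod.dist_eq]
    refine max_lt (by simpa using hδ) ?_
    rw [Subtype.dist_eq, Real.dist_eq, abs_of_nonneg (sub_nonneg.mpr (show (s : ℝ) ≤ t from hst))]
    exact hlt
  have := h hd
  rw [Real.dist_eq, ω.diagonal, sub_zero] at this
  rw [ω.val_of_le hst]
  exact (abs_lt.mp this).2

/-- The points dividing `[S, T]` into `M` intervals of equal length. -/
def gridPt (hST : S ≤ T) (M i : ℕ) : Set.Icc S T :=
  Set.projIcc S T hST (S + (T - S) * (i / M))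

theorem gridPt_monotone (hST : S ≤ T) (M : ℕ) : Monotone (gridPt hST M) := by
  intro i j hij
  apply Set.monotone_projIcc
  have : 0 ≤ T - S := by linarith
  gcongr

theorem gridPt_zero (hST : S ≤ T) (M : ℕ) : gridPt hST M 0 = ⟨S, Set.left_mem_Icc.mpr hST⟩ := by
  simp [gridPt]

theorem gridPt_self (hST : S ≤ T) {M : ℕ} (hM : 0 < M) :
    gridPt hST M M = ⟨T, Set.right_mem_Icc.mpr hST⟩ := by
  have : (M : ℝ) ≠ 0 := by positivity
  simp [gridPt, div_self this]

theorem gridPt_mul (hST : S ≤ T) (M : ℕ) {M' : ℕ} (hM' : 0 < M') (i : ℕ) :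
    gridPt hST (M * M') (i * M') = gridPt hST M i := by
  have : (M' : ℝ) ≠ 0 := by positivity
  simp only [gridPt, Nat.cast_mul]
  rw [mul_div_mul_right _ _ this]

theorem gridPt_succ_sub (hST : S ≤ T) {M : ℕ} (i : ℕ) :
    (gridPt hST M (i + 1) : ℝ) - gridPt hST M i ≤ (T - S) / M := by
  have h := Set.abs_projIcc_sub_projIcc (h := hST) (c := S + (T - S) * ((i + 1 : ℕ) / M))
    (d := S + (T - S) * ((i : ℕ) / M))
  have h' : |S + (T - S) * (((i + 1 : ℕ) : ℝ) / M) - (S + (T - S) * ((i : ℕ) / M))| =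
      (T - S) / M := by
    rw [show S + (T - S) * (((i + 1 : ℕ) : ℝ) / M) - (S + (T - S) * ((i : ℕ) / M)) =
      (T - S) / M by push_cast; ring]
    exact abs_of_nonneg (div_nonneg (by linarith) (by positivity))
  rw [h'] at h
  exact (le_abs_self _).trans h

theorem Control.sum_val_le (ω : Control S T) {x : ℕ → Set.Icc S T} (hx : Monotone x) (M : ℕ) :
    ∑ i ∈ Finset.range M, ω.val (x i) (x (i + 1)) ≤ ω.val (x 0) (x M) := by
  induction M with
  | zero => simp [ω.val_self]
  | succ M ih =>
    rw [Finset.sum_range_succ]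
    have := ω.val_superadditive (x 0) (x M) (x (M + 1)) (hx (Nat.zero_le _)) (hx (Nat.le_succ _))
    linarith

/-- Write `ω^θ = ω^(θ - 1) ω`: the first factor is uniformly small on a fine grid, and the second
sums to at most the total control by superadditivity. -/
theorem tendsto_sum_control_rpow (hST : S ≤ T) (ω : Control S T) {θ : ℝ} (hθ : 1 < θ) :
    Filter.Tendsto (fun M : ℕ => ∑ i ∈ Finset.range M,
      ω.val (gridPt hST M i) (gridPt hST M (i + 1)) ^ θ) Filter.atTop (nhds 0) := by
  set L := ω.val ⟨S, Set.left_mem_Icc.mpr hST⟩ ⟨T, Set.right_mem_Icc.mpr hST⟩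
  have hL : 0 ≤ L := ω.val_nonneg _ _
  rw [Metric.tendsto_atTop]
  intro ε hε
  -- The threshold `η` is chosen so that `η^(θ - 1) = ε / (L + 1)`; using `L + 1` rather than `L`
  -- avoids division by zero and makes the final inequality strict.
  have hη : 0 < (ε / (L + 1)) ^ (1 / (θ - 1)) := Real.rpow_pos_of_pos (by positivity) _
  set η := (ε / (L + 1)) ^ (1 / (θ - 1)) with hηdef
  have hηp : η ^ (θ - 1) = ε / (L + 1) := by
    rw [hηdef, ← Real.rpow_mul (by positivity), one_div_mul_cancel (by linarith), Real.rpow_one]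
  obtain ⟨δ, hδ, hω⟩ := exists_control_lt_of_sub_lt ω hη
  obtain ⟨M₀, hM₀⟩ := exists_nat_gt ((T - S) / δ)
  refine ⟨M₀ + 1, fun M hM => ?_⟩
  have hMpos : (0 : ℝ) < M := by exact_mod_cast (by omega : 0 < M)
  have hM' : (T - S) / M < δ := by
    rw [div_lt_iff₀ hδ] at hM₀
    rw [div_lt_iff₀ hMpos]
    have : (M₀ : ℝ) ≤ M := by exact_mod_cast (by omega : M₀ ≤ M)
    nlinarith
  have hsum : ∑ i ∈ Finset.range M, ω.val (gridPt hST M i) (gridPt hST M (i + 1)) ^ θ ≤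
      ε / (L + 1) * L := by
    calc ∑ i ∈ Finset.range M, ω.val (gridPt hST M i) (gridPt hST M (i + 1)) ^ θ
        ≤ ∑ i ∈ Finset.range M,
          ε / (L + 1) * ω.val (gridPt hST M i) (gridPt hST M (i + 1)) := by
          refine Finset.sum_le_sum fun i _ => ?_
          have hlt := hω _ _ (gridPt_monotone hST M (Nat.le_succ i))
            ((gridPt_succ_sub hST i).trans_lt hM')
          set v := ω.val (gridPt hST M i) (gridPt hST M (i + 1))
          have hv : 0 ≤ v := ω.val_nonneg _ _
          have : v ^ θ = v ^ (θ - 1) * v := by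
            rw [← Real.rpow_add_one' hv (by linarith), sub_add_cancel]
          rw [this, ← hηp]
          exact mul_le_mul_of_nonneg_right (Real.rpow_le_rpow hv hlt.le (by linarith)) hv
      _ = ε / (L + 1) * ∑ i ∈ Finset.range M,
          ω.val (gridPt hST M i) (gridPt hST M (i + 1)) := by rw [Finset.mul_sum]
      _ ≤ ε / (L + 1) * L := by
          refine mul_le_mul_of_nonneg_left ?_ (by positivity)
          have := ω.sum_val_le (gridPt_monotone hST M) M
          rwa [gridPt_zero, gridPt_self hST (by omega)] at this
  rw [Real.dist_0_eq_abs, abs_of_nonneg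
    (Finset.sum_nonneg fun i _ => Real.rpow_nonneg (ω.val_nonneg _ _) _)]
  refine hsum.trans_lt ?_
  rw [div_mul_eq_mul_div, div_lt_iff₀ (by positivity)]
  nlinarith

theorem sum_range_mul_eq_sum_sum_Ico {E : Type*} [AddCommMonoid E] (f : ℕ → E) (M M' : ℕ) :
    ∑ i ∈ Finset.range (M * M'), f i =
      ∑ i ∈ Finset.range M, ∑ j ∈ Finset.Ico (i * M') (i * M' + M'), f j := by
  induction M with
  | zero => simp
  | succ M ih =>
    rw [Finset.sum_range_succ, ← ih, Finset.range_eq_Ico, Finset.range_eq_Ico,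
      Finset.sum_Ico_consecutive _ (Nat.zero_le _) (Nat.le_add_right _ _), Nat.succ_mul]

variable {E : Type*} [NormedAddCommGroup E]

/-- The additive sewing lemma. -/
theorem exists_additive_near [CompleteSpace E] (hST : S ≤ T) (ω : Control S T) {K θ : ℝ}
    (hθ : 1 < θ) (hK : 0 ≤ K) {A : Set.Icc S T → Set.Icc S T → E}
    (hA : ∀ s u t, s ≤ u → u ≤ t → ‖A s u + A u t - A s t‖ ≤ K * ω.val s t ^ θ) :
    ∃ (C : ℝ) (W : Set.Icc S T → E), 0 ≤ C ∧
      ∀ s t, s ≤ t → ‖W t - W s - A s t‖ ≤ C * ω.val s t ^ θ := by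
  -- Almost additivity at `s = u = t` bounds `A s s` by a multiple of `0 ^ θ = 0`.
  have hA₀ : ∀ s, A s s = 0 := by
    intro s
    have := hA s s s le_rfl le_rfl
    rwa [ω.val_self, Real.zero_rpow (by linarith), mul_zero, add_sub_cancel_right,
      norm_le_zero_iff] at this
  have h2 : (2 : ℝ) ^ (1 - θ) < 1 := Real.rpow_lt_one_of_one_lt_of_neg one_lt_two (by linarith)
  set C : ℝ := 2 * K / (1 - 2 ^ (1 - θ)) with hC
  have hC0 : 0 ≤ C := div_nonneg (by positivity) (by linarith)
  have hmax : ∀ {x : ℕ → Set.Icc S T}, Monotone x → ∀ d m : ℕ,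
      ‖∑ i ∈ Finset.Ico m (m + d), A (x i) (x (i + 1)) - A (x m) (x (m + d))‖ ≤
        C * ω.val (x m) (x (m + d)) ^ θ := fun hx d m =>
    norm_sum_sub_le_of_almost_additive hθ ω.val_nonneg ω.val_self ω.val_superadditive hK hA₀ hA
      hx d m
  let x : ℕ → ℕ → Set.Icc S T := gridPt hST
  have hx : ∀ M, Monotone (x M) := gridPt_monotone hST
  let b : ℕ → ℝ := fun M => ∑ i ∈ Finset.range M, ω.val (x M i) (x M (i + 1)) ^ θ
  have hb : Filter.Tendsto b Filter.atTop (nhds 0) := tendsto_sum_control_rpow hST ω hθ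
  -- Riemann sums over the grid stopped at `t`; the intervals beyond `t` collapse to points and
  -- contribute zero. Their limit is `W t`.
  let P : ℕ → Set.Icc S T → E := fun M t =>
    ∑ i ∈ Finset.range M, A (min (x M i) t) (min (x M (i + 1)) t)
  have hmin : ∀ M t, Monotone fun i => min (x M i) t := fun M t i j hij =>
    min_le_min_right t (hx M hij)
  -- Grids of different sizes are compared through their common refinement `M * M'`, with the
  -- maximal inequality applied inside each coarse interval.
  have hcomp : ∀ t M M', 0 < M' → ‖P (M * M') t - P M t‖ ≤ C * b M := by
    intro t M M' hM'
    simp only [P, b]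
    rw [sum_range_mul_eq_sum_sum_Ico, ← Finset.sum_sub_distrib, Finset.mul_sum]
    refine norm_sum_le_of_le _ fun i _ => ?_
    have h := hmax (hmin (M * M') t) M' (i * M')
    rw [show i * M' + M' = (i + 1) * M' by ring] at h ⊢
    have e : ∀ i, x (M * M') (i * M') = x M i := gridPt_mul hST M hM'
    rw [e, e] at h
    refine h.trans (mul_le_mul_of_nonneg_left ?_ hC0)
    exact Real.rpow_le_rpow (ω.val_nonneg _ _) (ω.val_min_le t (hx M (Nat.le_succ i)))
      (by linarith)
  have hcauchy : ∀ t, CauchySeq fun M => P M t := by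
    intro t
    rw [Metric.cauchySeq_iff]
    intro ε hε
    have : ∀ᶠ M in Filter.atTop, b M < ε / (2 * (C + 1)) :=
      hb.eventually (gt_mem_nhds (by positivity))
    obtain ⟨M₀, hM₀⟩ := Filter.eventually_atTop.mp this
    refine ⟨M₀ + 1, fun m hm m' hm' => ?_⟩
    have h₁ := hcomp t m m' (by omega)
    have h₂ := hcomp t m' m (by omega)
    rw [mul_comm m' m] at h₂
    have h₃ : ∀ M ≥ M₀, C * b M ≤ C * (ε / (2 * (C + 1))) := fun M hM =>
      mul_le_mul_of_nonneg_left (hM₀ M hM).le hC0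
    have h₄ : C * (ε / (2 * (C + 1))) < ε / 2 := by
      rw [mul_div_assoc', div_lt_div_iff₀ (by positivity) two_pos]
      nlinarith
    have h₅ := h₃ m (by omega)
    have h₆ := h₃ m' (by omega)
    rw [dist_eq_norm, show P m t - P m' t =
      (P (m * m') t - P m' t) - (P (m * m') t - P m t) by abel]
    have := norm_sub_le (P (m * m') t - P m' t) (P (m * m') t - P m t)
    linarith
  choose W hW using fun t => cauchySeq_tendsto_of_complete (hcauchy t)
  refine ⟨C, W, hC0, fun s t hst => ?_⟩
  -- The sums up to `t` and up to `s` should differ by the sum over the grid clamped to `[s, t]`.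
  -- Only a grid interval with `s` in its interior can cause an error, a single defect of
  -- additivity.
  have hterm : ∀ a b : Set.Icc S T, a ≤ b →
      ‖A (min a t) (min b t) - A (min a s) (min b s) - A (max (min a t) s) (max (min b t) s)‖ ≤
        K * ω.val a b ^ θ := by
    intro a b hab
    have hpos : 0 ≤ K * ω.val a b ^ θ := mul_nonneg hK (Real.rpow_nonneg (ω.val_nonneg _ _) _)
    rcases le_total b s with hbs | hsb
    · have has := hab.trans hbs
      rw [min_eq_left (hbs.trans hst), min_eq_left (has.trans hst), min_eq_left hbs,
        min_eq_left has, max_eq_right hbs, max_eq_right has, hA₀, sub_self, sub_zero, norm_zero]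
      exact hpos
    rcases le_total s a with hsa | has
    · rw [min_eq_right hsa, min_eq_right hsb, hA₀, max_eq_left (le_min hsa hst),
        max_eq_left (le_min hsb hst), sub_zero, sub_self, norm_zero]
      exact hpos
    · rw [min_eq_left (has.trans hst), min_eq_left has, min_eq_right hsb, max_eq_right has,
        max_eq_left (le_min hsb hst), norm_sub_rev, show A s (min b t) - (A a (min b t) - A a s) =
        A a s + A s (min b t) - A a (min b t) by abel]
      refine (hA a s (min b t) has (le_min hsb hst)).trans (mul_le_mul_of_nonneg_left ?_ hK)
      exact Real.rpow_le_rpow (ω.val_nonneg _ _)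
        (ω.val_mono le_rfl (le_min hab (has.trans hst)) (min_le_left _ _)) (by linarith)
  -- The clamping errors add up to at most `K * b M`, which vanishes in the limit; the maximal
  -- inequality on the grid clamped to `[s, t]` leaves `C ω^θ`.
  have hbound : ∀ M, 0 < M →
      ‖P M t - P M s - A s t‖ ≤ K * b M + C * ω.val s t ^ θ := by
    intro M hM
    have hclamp : Monotone fun i => max (min (x M i) t) s := fun i j hij =>
      max_le_max_right s (hmin M t hij)
    have h₁ := hmax hclamp M 0
    simp only [zero_add] at h₁
    rw [show x M 0 = _ from gridPt_zero hST M, show x M M = _ from gridPt_self hST hM,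
      min_eq_left (show (⟨S, _⟩ : Set.Icc S T) ≤ t from t.2.1),
      max_eq_right (show (⟨S, _⟩ : Set.Icc S T) ≤ s from s.2.1),
      min_eq_right (show t ≤ (⟨T, _⟩ : Set.Icc S T) from t.2.2), max_eq_left hst,
      ← Finset.range_eq_Ico] at h₁
    have h₂ : ‖P M t - P M s - ∑ i ∈ Finset.range M,
        A (max (min (x M i) t) s) (max (min (x M (i + 1)) t) s)‖ ≤ K * b M := by
      simp only [P, b]
      rw [← Finset.sum_sub_distrib, ← Finset.sum_sub_distrib, Finset.mul_sum]
      exact norm_sum_le_of_le _ fun i _ => hterm _ _ (hx M (Nat.le_succ i))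
    refine (norm_sub_le_norm_sub_add_norm_sub _ _ _).trans (add_le_add h₂ h₁)
  have hlim := (((hW t).sub (hW s)).sub_const (A s t)).norm
  have hlim' : Filter.Tendsto (fun M => K * b M + C * ω.val s t ^ θ) Filter.atTop
      (nhds (K * 0 + C * ω.val s t ^ θ)) := (hb.const_mul K).add_const _
  have := le_of_tendsto_of_tendsto hlim hlim'
    (Filter.eventually_atTop.mpr ⟨1, fun M hM => hbound M hM⟩)
  simpa using this

/-- An additive function which is `O(ω^θ)` with `θ > 1` vanishes. -/
theorem eq_of_sub_le_control_rpow (hST : S ≤ T) (ω : Control S T) {K θ : ℝ} (hθ : 1 < θ)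
    (hK : 0 ≤ K) {W : Set.Icc S T → E}
    (hW : ∀ s t, s ≤ t → ‖W t - W s‖ ≤ K * ω.val s t ^ θ) (s t : Set.Icc S T) : W s = W t := by
  suffices h : ∀ t, W ⟨S, Set.left_mem_Icc.mpr hST⟩ = W t from (h s).symm.trans (h t)
  intro t
  have hb := (tendsto_sum_control_rpow hST ω hθ).const_mul K
  rw [mul_zero] at hb
  refine (sub_eq_zero.mp (norm_le_zero_iff.mp (ge_of_tendsto hb
    (Filter.eventually_atTop.mpr ⟨1, fun M hM => ?_⟩)))).symm
  -- Stopping the grid at `t` makes the telescoping sum run from `S` to `t`, while each increment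
  -- remains bounded by the control of the full grid interval.
  have e := Finset.sum_range_sub (fun i => W (min (gridPt hST M i) t)) M
  rw [gridPt_zero, gridPt_self hST hM,
    min_eq_left (show (⟨S, _⟩ : Set.Icc S T) ≤ t from t.2.1),
    min_eq_right (show t ≤ (⟨T, _⟩ : Set.Icc S T) from t.2.2)] at e
  rw [← e, Finset.mul_sum]
  refine norm_sum_le_of_le _ fun i _ => ?_
  have hle := gridPt_monotone hST M (Nat.le_succ i)
  refine (hW _ _ (min_le_min_right t hle)).trans (mul_le_mul_of_nonneg_left ?_ hK)
  exact Real.rpow_le_rpow (ω.val_nonneg _ _) (ω.val_min_le t hle) (by linarith)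

end RoughPath

namespace RoughPath

/-! ### Functions on the simplex controlled by a power of a control -/

section Controlled

variable {S T : ℝ} {E : Type*} [NormedAddCommGroup E]

/-- `f = O(ω^a)` on the simplex. -/
def ControlledBy (ω : Control S T) (a : ℝ) (f : Simplex S T → E) : Prop :=
  ∃ K : ℝ, 0 ≤ K ∧ ∀ q, ‖f q‖ ≤ K * ω q ^ a

theorem exists_control_le (ω : Control S T) : ∃ M : ℝ, 0 ≤ M ∧ ∀ q, ω q ≤ M := by
  obtain ⟨M, hM⟩ := isCompact_univ.exists_bound_of_continuousOn ω.continuous_toFun.continuousOn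
  refine ⟨max M 0, le_max_right _ _, fun q => ?_⟩
  exact (le_abs_self _).trans ((hM q trivial).trans (le_max_left _ _))

/-- A control is bounded on the compact simplex, so exponents can be lowered at the cost of a
constant. -/
theorem exists_control_rpow_le (ω : Control S T) {a b : ℝ} (hb : 0 ≤ b) (hab : b ≤ a) :
    ∃ C : ℝ, 0 ≤ C ∧ ∀ q, ω q ^ a ≤ C * ω q ^ b := by
  obtain ⟨M, hM, h⟩ := exists_control_le ω
  refine ⟨M ^ (a - b), Real.rpow_nonneg hM _, fun q => ?_⟩
  have e : ω q ^ a = ω q ^ (a - b) * ω q ^ b := by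
    rw [← Real.rpow_add_of_nonneg (ω.nonneg q) (by linarith) hb, sub_add_cancel]
  rw [e]
  exact mul_le_mul_of_nonneg_right (Real.rpow_le_rpow (ω.nonneg q) (h q) (by linarith))
    (Real.rpow_nonneg (ω.nonneg q) _)

theorem ControlledBy.mono_exponent {ω : Control S T} {a b : ℝ} {f : Simplex S T → E}
    (hf : ControlledBy ω a f) (hb : 0 ≤ b) (hab : b ≤ a) : ControlledBy ω b f := by
  obtain ⟨K, hK, h⟩ := hf
  obtain ⟨C, hC, h'⟩ := exists_control_rpow_le ω hb hab
  refine ⟨K * C, mul_nonneg hK hC, fun q => (h q).trans ?_⟩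
  rw [mul_assoc]
  exact mul_le_mul_of_nonneg_left (h' q) hK

theorem ControlledBy.mono_control {ω ω' : Control S T} {a : ℝ} {f : Simplex S T → E}
    (hf : ControlledBy ω a f) (ha : 0 ≤ a) (h : ∀ q, ω q ≤ ω' q) : ControlledBy ω' a f := by
  obtain ⟨K, hK, h'⟩ := hf
  refine ⟨K, hK, fun q => (h' q).trans (mul_le_mul_of_nonneg_left ?_ hK)⟩
  exact Real.rpow_le_rpow (ω.nonneg q) (h q) ha

theorem ControlledBy.zero (ω : Control S T) (a : ℝ) :
    ControlledBy ω a (fun _ => (0 : E)) :=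
  ⟨0, le_rfl, fun q => by simp⟩

theorem ControlledBy.add {ω : Control S T} {a : ℝ} {f g : Simplex S T → E}
    (hf : ControlledBy ω a f) (hg : ControlledBy ω a g) :
    ControlledBy ω a (fun q => f q + g q) := by
  obtain ⟨K, hK, h⟩ := hf
  obtain ⟨K', hK', h'⟩ := hg
  refine ⟨K + K', add_nonneg hK hK', fun q => (norm_add_le _ _).trans ?_⟩
  rw [add_mul]
  exact add_le_add (h q) (h' q)

theorem ControlledBy.neg {ω : Control S T} {a : ℝ} {f : Simplex S T → E}
    (hf : ControlledBy ω a f) : ControlledBy ω a (fun q => -f q) := by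
  obtain ⟨K, hK, h⟩ := hf
  exact ⟨K, hK, fun q => by rw [norm_neg]; exact h q⟩

theorem ControlledBy.sub {ω : Control S T} {a : ℝ} {f g : Simplex S T → E}
    (hf : ControlledBy ω a f) (hg : ControlledBy ω a g) :
    ControlledBy ω a (fun q => f q - g q) := by
  simpa only [sub_eq_add_neg] using hf.add hg.neg

theorem ControlledBy.smul [NormedSpace ℝ E] {ω : Control S T} {a : ℝ} {f : Simplex S T → E}
    (hf : ControlledBy ω a f) (c : ℝ) : ControlledBy ω a (fun q => c • f q) := by
  obtain ⟨K, hK, h⟩ := hf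
  refine ⟨‖c‖ * K, by positivity, fun q => ?_⟩
  rw [norm_smul, mul_assoc]
  exact mul_le_mul_of_nonneg_left (h q) (norm_nonneg c)

/-- The sum of two controls. -/
def Control.add (ω ω' : Control S T) : Control S T where
  toFun q := ω q + ω' q
  continuous_toFun := ω.continuous_toFun.add ω'.continuous_toFun
  nonneg q := add_nonneg (ω.nonneg q) (ω'.nonneg q)
  superadditive s u t hsu hut := by
    have h := ω.superadditive s u t hsu hut
    have h' := ω'.superadditive s u t hsu hut
    linarith
  diagonal t := by rw [ω.diagonal, ω'.diagonal, add_zero]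

theorem Control.le_add_left (ω ω' : Control S T) (q : Simplex S T) : ω q ≤ ω.add ω' q :=
  le_add_of_nonneg_right (ω'.nonneg q)

theorem Control.le_add_right (ω ω' : Control S T) (q : Simplex S T) : ω' q ≤ ω.add ω' q :=
  le_add_of_nonneg_left (ω.nonneg q)

/-- The zero control. -/
def Control.zero (S T : ℝ) : Control S T where
  toFun _ := 0
  continuous_toFun := continuous_const
  nonneg _ := le_rfl
  superadditive _ _ _ _ _ := by simp
  diagonal _ := rfl

theorem Control.le_of_le (ω : Control S T) {s u t : Set.Icc S T} (hsu : s ≤ u) (hut : u ≤ t) :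
    ω (pt hsu) ≤ ω (pt (hsu.trans hut)) ∧ ω (pt hut) ≤ ω (pt (hsu.trans hut)) := by
  have h := ω.superadditive s u t hsu hut
  have h₁ := ω.nonneg (pt hsu)
  have h₂ := ω.nonneg (pt hut)
  constructor <;> linarith

theorem continuous_of_sub_controlled (ω : Control S T) {K ε : ℝ} (hε : 0 < ε) (hK : 0 ≤ K)
    {W : Set.Icc S T → E} (hW : ∀ s t, s ≤ t → ‖W t - W s‖ ≤ K * ω.val s t ^ ε) :
    Continuous W := by
  rw [Metric.continuous_iff]
  intro t η hη
  have hc : 0 < (η / (K + 1)) ^ (1 / ε) := Real.rpow_pos_of_pos (by positivity) _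
  obtain ⟨δ, hδ, h⟩ := exists_control_lt_of_sub_lt ω hc
  have key : ∀ s t : Set.Icc S T, s ≤ t → (t : ℝ) - s < δ → dist (W t) (W s) < η := by
    intro s t hst hlt
    have h₁ := Real.rpow_le_rpow (ω.val_nonneg s t) (h s t hst hlt).le hε.le
    rw [← Real.rpow_mul (by positivity), one_div_mul_cancel hε.ne', Real.rpow_one] at h₁
    rw [dist_eq_norm]
    refine (hW s t hst).trans_lt ((mul_le_mul_of_nonneg_left h₁ hK).trans_lt ?_)
    rw [mul_div_assoc', div_lt_iff₀ (by positivity)]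
    nlinarith
  refine ⟨δ, hδ, fun s hs => ?_⟩
  rw [Subtype.dist_eq, Real.dist_eq] at hs
  rcases le_total s t with hst | hst
  · rw [dist_comm]
    exact key s t hst (by rw [abs_sub_comm] at hs; exact (abs_lt.mp hs).2)
  · exact key t s hst (abs_lt.mp hs).2

end Controlled

variable {V : Type*} [NormedAddCommGroup V] [NormedSpace ℝ V]
variable {N : AdmissibleNorms V} {S T : ℝ} {n : ℕ}

/-! ### Controlled functionals -/

/-- For every degree `i ≥ 1` the component of degree `i` is `O(ω^{e i})`. -/
def LevelControlled (ω : Control S T) (e : ℕ → ℝ) (X : Functional N S T n) : Prop :=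
  ∀ i : Fin (n + 1), 1 ≤ (i : ℕ) → ControlledBy ω (e i) (fun q => X q i)

/-- The functional preserves the unit and satisfies Chen's identity. -/
def IsChen (X : Functional N S T n) : Prop :=
  (∀ q, X q 0 = scalarOne N) ∧
    ∀ (s u t : Set.Icc S T) (hsu : s ≤ u) (hut : u ≤ t),
      tmul (X (pt hsu)) (X (pt hut)) = X (pt (hsu.trans hut))

theorem functional_ext {X Y : Functional N S T (n + 1)}
    (h : trunc (Nat.le_succ n) X = trunc (Nat.le_succ n) Y) (h' : top X = top Y) : X = Y :=
  funext fun q => ext_initComp_lastComp (congrFun h q) (congrFun h' q)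

@[simp]
theorem trunc_append (X : Functional N S T n) (ψ : Simplex S T → N.Pow (n + 1)) :
    trunc (Nat.le_succ n) (append X ψ) = X :=
  funext fun q => initComp_snocComp (X q) (ψ q)

@[simp]
theorem top_append (X : Functional N S T n) (ψ : Simplex S T → N.Pow (n + 1)) :
    top (append X ψ) = ψ :=
  funext fun q => lastComp_snocComp (X q) (ψ q)

theorem levelControlled_succ {ω : Control S T} {e : ℕ → ℝ} {X : Functional N S T (n + 1)} :
    LevelControlled ω e X ↔
      LevelControlled ω e (trunc (Nat.le_succ n) X) ∧ ControlledBy ω (e (n + 1)) (top X) := by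
  constructor
  · intro h
    exact ⟨fun i hi => h i.castSucc hi, h (Fin.last _) (Nat.le_add_left _ _)⟩
  · rintro ⟨h, h'⟩ i
    exact Fin.lastCases
      (motive := fun i => 1 ≤ (i : ℕ) → ControlledBy ω (e i) (fun q => X q i))
      (fun _ => h') (fun i hi => h i hi) i

theorem levelControlled_zero (ω : Control S T) (e : ℕ → ℝ) (X : Functional N S T 0) :
    LevelControlled ω e X := fun i hi => by omega

theorem LevelControlled.mono_exponent {ω : Control S T} {e f : ℕ → ℝ} {X : Functional N S T n}
    (h : LevelControlled ω e X) (hf : ∀ i, 1 ≤ i → i ≤ n → 0 ≤ f i)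
    (hef : ∀ i, 1 ≤ i → i ≤ n → f i ≤ e i) : LevelControlled ω f X := fun i hi =>
  (h i hi).mono_exponent (hf i hi (Nat.lt_succ_iff.mp i.2)) (hef i hi (Nat.lt_succ_iff.mp i.2))

theorem LevelControlled.mono_control {ω ω' : Control S T} {e : ℕ → ℝ} {X : Functional N S T n}
    (h : LevelControlled ω e X) (he : ∀ i, 1 ≤ i → i ≤ n → 0 ≤ e i)
    (hω : ∀ q, ω q ≤ ω' q) : LevelControlled ω' e X := fun i hi =>
  (h i hi).mono_control (he i hi (Nat.lt_succ_iff.mp i.2)) hω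

theorem LevelControlled.add {ω : Control S T} {e : ℕ → ℝ} {X Y : Functional N S T n}
    (hX : LevelControlled ω e X) (hY : LevelControlled ω e Y) : LevelControlled ω e (X + Y) :=
  fun i hi => (hX i hi).add (hY i hi)

theorem LevelControlled.sub {ω : Control S T} {e : ℕ → ℝ} {X Y : Functional N S T n}
    (hX : LevelControlled ω e X) (hY : LevelControlled ω e Y) : LevelControlled ω e (X - Y) :=
  fun i hi => (hX i hi).sub (hY i hi)

theorem LevelControlled.smul {ω : Control S T} {e : ℕ → ℝ} {X : Functional N S T n}
    (hX : LevelControlled ω e X) (c : ℝ) : LevelControlled ω e (c • X) :=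
  fun i hi => (hX i hi).smul c

theorem LevelControlled.exists_bound {ω : Control S T} {e : ℕ → ℝ} {X : Functional N S T n}
    (h : LevelControlled ω e X) : ∃ K : ℝ, 0 ≤ K ∧ ∀ i : Fin (n + 1), 1 ≤ (i : ℕ) →
      ∀ q, ‖X q i‖ ≤ K * ω q ^ e i := by
  choose! K hK hX using h
  -- Absolute values are needed because the constant chosen for degree zero is arbitrary and might
  -- be negative.
  refine ⟨∑ i : Fin (n + 1), |K i|, Finset.sum_nonneg fun _ _ => abs_nonneg _,
    fun i hi q => (hX i hi q).trans (mul_le_mul_of_nonneg_right ?_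
      (Real.rpow_nonneg (ω.nonneg q) _))⟩
  exact (le_abs_self _).trans
    (Finset.single_le_sum (f := fun i => |K i|) (fun _ _ => abs_nonneg _) (Finset.mem_univ i))

theorem one_le_beta {p : ℝ} (hp : 1 ≤ p) : 1 ≤ beta p := by
  have h : 0 ≤ ∑' r : ℕ, (2 / ((r : ℝ) + 1)) ^ (((⌊p⌋₊ : ℝ) + 1) / p) :=
    tsum_nonneg fun r => Real.rpow_nonneg (by positivity) _
  unfold beta
  nlinarith

/-- The factors `β(p)` and `(i/p)!` are positive and only finitely many degrees occur, so they can
be absorbed into the constant. -/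
theorem hasPVariation_iff {p : ℝ} (hp : 1 ≤ p) (ω : Control S T) (X : Functional N S T n) :
    (∃ K : ℝ, 0 ≤ K ∧ HasPVariation p ω K X) ↔ LevelControlled ω (fun i => (i : ℝ) / p) X := by
  have hβ : 0 < beta p := one_pos.trans_le (one_le_beta hp)
  have hΓ : ∀ i : ℕ, 0 < Real.Gamma ((i : ℝ) / p + 1) := fun i =>
    Real.Gamma_pos_of_pos (by positivity)
  constructor
  · rintro ⟨K, hK, h⟩ i hi
    refine ⟨K / (beta p * Real.Gamma ((i : ℝ) / p + 1)),
      div_nonneg hK (mul_pos hβ (hΓ i)).le, fun q => (h i hi q).trans (le_of_eq ?_)⟩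
    ring
  · intro h
    obtain ⟨K, hK, h⟩ := h.exists_bound
    have hG : ∀ i : Fin (n + 1), Real.Gamma ((i : ℝ) / p + 1) ≤
        ∑ j : Fin (n + 1), Real.Gamma ((j : ℝ) / p + 1) := fun i =>
      Finset.single_le_sum (f := fun j : Fin (n + 1) => Real.Gamma ((j : ℝ) / p + 1))
        (fun j _ => (hΓ j).le) (Finset.mem_univ i)
    refine ⟨K * (beta p * ∑ j : Fin (n + 1), Real.Gamma ((j : ℝ) / p + 1)),
      mul_nonneg hK (mul_nonneg hβ.le (Finset.sum_nonneg fun j _ => (hΓ j).le)),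
      fun i hi q => (h i hi q).trans ?_⟩
    have hp0 : 0 ≤ ω q ^ ((i : ℝ) / p) := Real.rpow_nonneg (ω.nonneg q) _
    rw [mul_div_assoc', le_div_iff₀ (mul_pos hβ (hΓ i))]
    calc K * ω q ^ ((i : ℝ) / p) * (beta p * Real.Gamma ((i : ℝ) / p + 1))
        ≤ K * ω q ^ ((i : ℝ) / p) * (beta p * ∑ j : Fin (n + 1), Real.Gamma ((j : ℝ) / p + 1)) :=
          mul_le_mul_of_nonneg_left (mul_le_mul_of_nonneg_left (hG i) hβ.le)
            (mul_nonneg hK hp0)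
      _ = _ := by ring

theorem mem_omega_iff {p : ℝ} (hp : 1 ≤ p) {X : Functional N S T n} :
    X ∈ Omega N S T n p ↔
      IsMultiplicative X ∧ ∃ ω : Control S T, LevelControlled ω (fun i => (i : ℝ) / p) X := by
  constructor
  · rintro ⟨ω, K, hK, hm, h⟩
    exact ⟨hm, ω, (hasPVariation_iff hp ω X).mp ⟨K, hK, h⟩⟩
  · rintro ⟨hm, ω, h⟩
    obtain ⟨K, hK, h⟩ := (hasPVariation_iff hp ω X).mpr h
    exact ⟨ω, K, hK, hm, h⟩

/-- A bound for the mixed terms of the product over two adjacent intervals. -/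
theorem exists_norm_cross_le {ω : Control S T} {e f : ℕ → ℝ} {a : ℝ} {X Y : Functional N S T n}
    (hX : LevelControlled ω e X) (hY : LevelControlled ω f Y) (ha : 0 ≤ a)
    (he : ∀ i, 1 ≤ i → i ≤ n → 0 ≤ e i) (hf : ∀ i, 1 ≤ i → i ≤ n → 0 ≤ f i)
    (hef : ∀ i j, 1 ≤ i → 1 ≤ j → i + j = n + 1 → a ≤ e i + f j) :
    ∃ K : ℝ, 0 ≤ K ∧ ∀ (s u t : Set.Icc S T) (hsu : s ≤ u) (hut : u ≤ t),
      ‖cross (X (pt hsu)) (Y (pt hut))‖ ≤ K * ω (pt (hsu.trans hut)) ^ a := by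
  obtain ⟨K, hK, hX⟩ := hX.exists_bound
  obtain ⟨K', hK', hY⟩ := hY.exists_bound
  have hC : ∀ i : Fin n, ∃ C : ℝ, 0 ≤ C ∧
      ∀ q, ω q ^ (e (i + 1) + f (n + 1 - (i + 1))) ≤ C * ω q ^ a := fun i =>
    exists_control_rpow_le ω ha (hef _ _ (by omega) (by omega) (by omega))
  choose C hC0 hC using hC
  refine ⟨∑ i : Fin n, K * K' * C i,
    Finset.sum_nonneg fun i _ => mul_nonneg (mul_nonneg hK hK') (hC0 i),
    fun s u t hsu hut => (norm_cross_le _ _).trans ?_⟩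
  rw [Finset.sum_mul]
  refine Finset.sum_le_sum fun i _ => ?_
  have h₁ := hX ⟨i + 1, by omega⟩ (by simp) (pt hsu)
  have h₂ := hY ⟨n + 1 - ((i : ℕ) + 1), by omega⟩ (by simp only; omega) (pt hut)
  obtain ⟨l₁, l₂⟩ := ω.le_of_le hsu hut
  have he' : 0 ≤ e (i + 1) := he _ (by omega) (by omega)
  have hf' : 0 ≤ f (n + 1 - (i + 1)) := hf _ (by omega) (by omega)
  have r₁ := Real.rpow_le_rpow (ω.nonneg _) l₁ he'
  have r₂ := Real.rpow_le_rpow (ω.nonneg _) l₂ hf'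
  have z := ω.nonneg (pt (hsu.trans hut))
  calc _ ≤ (K * ω (pt (hsu.trans hut)) ^ e (i + 1)) *
        (K' * ω (pt (hsu.trans hut)) ^ f (n + 1 - (i + 1))) :=
        mul_le_mul (h₁.trans (mul_le_mul_of_nonneg_left r₁ hK))
          (h₂.trans (mul_le_mul_of_nonneg_left r₂ hK')) (norm_nonneg _)
          (mul_nonneg hK (Real.rpow_nonneg z _))
    _ = K * K' * ω (pt (hsu.trans hut)) ^ (e (i + 1) + f (n + 1 - (i + 1))) := by
        rw [Real.rpow_add_of_nonneg z he' hf']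
        ring
    _ ≤ K * K' * (C i * ω (pt (hsu.trans hut)) ^ a) :=
        mul_le_mul_of_nonneg_left (hC i _) (mul_nonneg hK hK')
    _ = _ := by ring

/-! ### Chen's identity, degree by degree -/

theorem top_chen {X : Functional N S T (n + 1)} (h₀ : ∀ q, X q 0 = scalarOne N)
    (s u t : Set.Icc S T) (hsu : s ≤ u) (hut : u ≤ t) :
    lastComp (tmul (X (pt hsu)) (X (pt hut))) = top X (pt hsu) + top X (pt hut) +
      cross (trunc (Nat.le_succ n) X (pt hsu)) (trunc (Nat.le_succ n) X (pt hut)) :=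
  lastComp_tmul (h₀ _) (h₀ _)

/-- This splitting drives all the inductions: given the lower degrees, the top level satisfies an
additive equation with a known inhomogeneity. -/
theorem isChen_succ {X : Functional N S T (n + 1)} :
    IsChen X ↔ IsChen (trunc (Nat.le_succ n) X) ∧
      ∀ (s u t : Set.Icc S T) (hsu : s ≤ u) (hut : u ≤ t), top X (pt hsu) + top X (pt hut) +
        cross (trunc (Nat.le_succ n) X (pt hsu)) (trunc (Nat.le_succ n) X (pt hut)) =
          top X (pt (hsu.trans hut)) := by
  constructor
  · rintro ⟨h₀, h⟩
    refine ⟨⟨h₀, fun s u t hsu hut => congrArg initComp (h s u t hsu hut)⟩,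
      fun s u t hsu hut => ?_⟩
    rw [← top_chen h₀, h]
    rfl
  · rintro ⟨⟨h₀, h⟩, h'⟩
    refine ⟨h₀, fun s u t hsu hut => ext_initComp_lastComp (h s u t hsu hut) ?_⟩
    rw [top_chen h₀, h']
    rfl

theorem isChen_zero_iff {X : Functional N S T 0} : IsChen X ↔ X = one N S T 0 := by
  constructor
  · rintro ⟨h, -⟩
    funext q i
    obtain rfl : i = 0 := Fin.fin_one_eq_zero i
    exact h q
  · rintro rfl
    refine ⟨fun q => rfl, fun s u t hsu hut => ?_⟩
    funext i
    obtain rfl : i = 0 := Fin.fin_one_eq_zero i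
    exact tmul_zero_apply rfl rfl

theorem isChen_trunc {m : ℕ} {X : Functional N S T n} (hX : IsChen X) (h : m ≤ n) :
    IsChen (trunc h X) :=
  ⟨hX.1, fun s u t hsu hut => funext fun i =>
    congrFun (hX.2 s u t hsu hut) (Fin.castLE (Nat.succ_le_succ h) i)⟩

theorem levelControlled_trunc {m : ℕ} {ω : Control S T} {e : ℕ → ℝ} {X : Functional N S T n}
    (hX : LevelControlled ω e X) (h : m ≤ n) : LevelControlled ω e (trunc h X) :=
  fun i hi => hX (Fin.castLE (Nat.succ_le_succ h) i) hi

/-! ### Uniqueness, sewing and regularity by induction on the degree -/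

theorem eq_zero_of_additive_controlled {E : Type*} [NormedAddCommGroup E] (hST : S ≤ T)
    {ω : Control S T} {θ : ℝ} (hθ : 1 < θ) {D : Simplex S T → E}
    (hadd : ∀ (s u t : Set.Icc S T) (hsu : s ≤ u) (hut : u ≤ t),
      D (pt hsu) + D (pt hut) = D (pt (hsu.trans hut)))
    (hD : ControlledBy ω θ D) : D = 0 := by
  obtain ⟨K, hK, hD⟩ := hD
  have hS : ∀ t : Set.Icc S T, (⟨S, Set.left_mem_Icc.mpr hST⟩ : Set.Icc S T) ≤ t := fun t => t.2.1
  have key : ∀ (s t : Set.Icc S T) (h : s ≤ t), D (pt (hS t)) - D (pt (hS s)) = D (pt h) := by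
    intro s t h
    rw [← hadd _ s t (hS s) h, add_sub_cancel_left]
  have hW := eq_of_sub_le_control_rpow hST ω hθ hK (W := fun t => D (pt (hS t)))
    fun s t h => by rw [key s t h, ω.val_of_le h]; exact hD _
  funext q
  have := key q.1.1 q.1.2 q.2
  rw [hW q.1.1 q.1.2, sub_self] at this
  exact this.symm

/-- Once the lower degrees agree, the cross terms coincide, so the difference of the top levels is
additive and `O(ω^θ)`, hence zero. -/
theorem IsChen.eq_of_sub_controlled (hST : S ≤ T) {ω : Control S T} {θ : ℝ} (hθ : 1 < θ)
    {X Y : Functional N S T n} (hX : IsChen X) (hY : IsChen Y)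
    (h : LevelControlled ω (fun _ => θ) (X - Y)) : X = Y := by
  induction n with
  | zero => rw [isChen_zero_iff.mp hX, isChen_zero_iff.mp hY]
  | succ n ih =>
    rw [levelControlled_succ] at h
    rw [isChen_succ] at hX hY
    have e := ih hX.1 hY.1 h.1
    refine functional_ext e (sub_eq_zero.mp (eq_zero_of_additive_controlled hST hθ ?_ h.2))
    intro s u t hsu hut
    have h₁ := hX.2 s u t hsu hut
    have h₂ := hY.2 s u t hsu hut
    rw [e] at h₁
    simp only [Pi.sub_apply]
    rw [← h₁, ← h₂]
    abel

/-- Sewing in the highest degree, over a functional satisfying Chen's identity. -/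
theorem exists_chen_append [CompleteSpace V] (hST : S ≤ T) {ω : Control S T} {θ : ℝ} (hθ : 1 < θ)
    {Y : Functional N S T n} (hY : IsChen Y) {Ξ : Simplex S T → N.Pow (n + 1)}
    (hΞ : ∃ K : ℝ, 0 ≤ K ∧ ∀ (s u t : Set.Icc S T) (hsu : s ≤ u) (hut : u ≤ t),
      ‖Ξ (pt hsu) + Ξ (pt hut) + cross (Y (pt hsu)) (Y (pt hut)) - Ξ (pt (hsu.trans hut))‖ ≤
        K * ω (pt (hsu.trans hut)) ^ θ) :
    ∃ ψ : Simplex S T → N.Pow (n + 1), IsChen (append Y ψ) ∧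
      ControlledBy ω θ (fun q => ψ q - Ξ q) := by
  obtain ⟨K, hK, hΞ⟩ := hΞ
  have hS : ∀ t : Set.Icc S T, (⟨S, Set.left_mem_Icc.mpr hST⟩ : Set.Icc S T) ≤ t := fun t => t.2.1
  -- By the cocycle identity the cross term is the additivity defect of `g(s, t) = cross(Y_{S,s},
  -- Y_{s,t})`. So `Ξ + g` is almost additive in the plain sense, and subtracting `g` from its
  -- sewing restores Chen's identity.
  let g : Simplex S T → N.Pow (n + 1) := fun q => cross (Y (pt (hS q.1.1))) (Y q)
  have hg : ∀ (s u t : Set.Icc S T) (hsu : s ≤ u) (hut : u ≤ t),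
      g (pt hsu) + g (pt hut) =
        cross (Y (pt hsu)) (Y (pt hut)) + g (pt (hsu.trans hut)) := by
    intro s u t hsu hut
    have := cross_cocycle (hY.1 (pt (hS s))) (hY.1 (pt hsu)) (hY.1 (pt hut))
    rwa [hY.2, hY.2] at this
  obtain ⟨C, W, hC, hW⟩ := exists_additive_near hST ω hθ hK
    (A := fun s t => if h : s ≤ t then Ξ (pt h) + g (pt h) else 0) (by
      intro s u t hsu hut
      rw [dif_pos hsu, dif_pos hut, dif_pos (hsu.trans hut), ω.val_of_le (hsu.trans hut)]
      refine le_trans (le_of_eq (congrArg _ ?_)) (hΞ s u t hsu hut)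
      have := hg s u t hsu hut
      rw [show Ξ (pt hsu) + g (pt hsu) + (Ξ (pt hut) + g (pt hut)) -
        (Ξ (pt (hsu.trans hut)) + g (pt (hsu.trans hut))) = Ξ (pt hsu) + Ξ (pt hut) +
        (g (pt hsu) + g (pt hut)) - (Ξ (pt (hsu.trans hut)) + g (pt (hsu.trans hut))) by abel,
        this]
      abel)
  refine ⟨fun q => W q.1.2 - W q.1.1 - g q, isChen_succ.mpr ⟨?_, ?_⟩, C, hC, fun q => ?_⟩
  · rwa [trunc_append]
  · intro s u t hsu hut
    rw [trunc_append, top_append]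
    have := hg s u t hsu hut
    simp only
    rw [show W u - W s - g (pt hsu) + (W t - W u - g (pt hut)) = W t - W s -
      (g (pt hsu) + g (pt hut)) by abel, this]
    abel
  · have := hW q.1.1 q.1.2 q.2
    rw [dif_pos q.2, ω.val_of_le q.2] at this
    rw [add_comm (Ξ _), ← sub_sub] at this
    exact this

theorem levelControlled_const_zero_of {ω : Control S T} {e : ℕ → ℝ} {X : Functional N S T n}
    (h : LevelControlled ω e X) (he : ∀ i, 1 ≤ i → i ≤ n → 0 ≤ e i) :
    LevelControlled ω (fun _ => 0) X :=
  h.mono_exponent (fun _ _ _ => le_rfl) he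

/-- Sewing of almost multiplicative functionals. -/
theorem exists_chen_near [CompleteSpace V] (hST : S ≤ T) {ω : Control S T} {K θ : ℝ} (hθ : 1 < θ)
    (hK : 0 ≤ K) {X : Functional N S T n} (h₀ : ∀ q, X q 0 = scalarOne N)
    (hb : LevelControlled ω (fun _ => 0) X)
    (h : ∀ (s u t : Set.Icc S T) (hsu : s ≤ u) (hut : u ≤ t) (i : Fin (n + 1)), 1 ≤ (i : ℕ) →
      ‖tmul (X (pt hsu)) (X (pt hut)) i - X (pt (hsu.trans hut)) i‖
        ≤ K * ω (pt (hsu.trans hut)) ^ θ) :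
    ∃ Y : Functional N S T n, IsChen Y ∧ LevelControlled ω (fun _ => θ) (Y - X) := by
  induction n with
  | zero => exact ⟨one N S T 0, isChen_zero_iff.mpr rfl, levelControlled_zero _ _ _⟩
  | succ n ih =>
    rw [levelControlled_succ] at hb
    obtain ⟨Y, hY, hYX⟩ := ih (X := trunc (Nat.le_succ n) X) h₀ hb.1
      fun s u t hsu hut i hi => h s u t hsu hut i.castSucc hi
    have hYb : LevelControlled ω (fun _ => 0) Y := by
      have := (hYX.mono_exponent (f := fun _ => 0) (fun _ _ _ => le_rfl)
        (fun _ _ _ => by linarith)).add hb.1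
      rwa [sub_add_cancel] at this
    -- Replacing the lower levels of `X` by those of `Y` changes the cross term by a product of an
    -- `O(ω^θ)` factor and a bounded one, once on each side.
    obtain ⟨K₁, hK₁, h₁⟩ := exists_norm_cross_le (a := θ) hYX hYb (by linarith)
      (fun _ _ _ => by linarith) (fun _ _ _ => le_rfl) (fun _ _ _ _ _ => by linarith)
    obtain ⟨K₂, hK₂, h₂⟩ := exists_norm_cross_le (a := θ) hb.1 hYX (by linarith)
      (fun _ _ _ => le_rfl) (fun _ _ _ => by linarith) (fun _ _ _ _ _ => by linarith)
    obtain ⟨ψ, hψ, hψX⟩ := exists_chen_append hST hθ hY (Ξ := top X)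
      ⟨K + K₁ + K₂, by positivity, fun s u t hsu hut => by
        have h₃ : ‖lastComp (tmul (X (pt hsu)) (X (pt hut))) - top X (pt (hsu.trans hut))‖ ≤
            K * ω (pt (hsu.trans hut)) ^ θ :=
          h s u t hsu hut (Fin.last _) (Nat.le_add_left _ _)
        rw [top_chen h₀] at h₃
        have h₄ := cross_sub_cross (Y (pt hsu)) (Y (pt hut)) (trunc (Nat.le_succ n) X (pt hsu))
          (trunc (Nat.le_succ n) X (pt hut))
        rw [sub_eq_iff_eq_add] at h₄
        have h₅ := h₁ s u t hsu hut
        have h₆ := h₂ s u t hsu hut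
        rw [h₄, add_mul, add_mul]
        refine le_trans (le_of_eq (congrArg _ ?_)) ((norm_add₃_le).trans
          (add_le_add (add_le_add h₃ h₅) h₆))
        simp only [Pi.sub_apply]
        abel⟩
    refine ⟨append Y ψ, hψ, levelControlled_succ.mpr ⟨?_, ?_⟩⟩
    · have : trunc (Nat.le_succ n) (append Y ψ - X) = Y - trunc (Nat.le_succ n) X := by
        conv_rhs => rw [← trunc_append Y ψ]
        rfl
      rwa [this]
    · have : top (append Y ψ - X) = fun q => ψ q - top X q := by
        conv_rhs => rw [← top_append Y ψ]
        rfl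
      rwa [this]

/-- Closeness to `X` alone gives only the exponent `θ` in the degrees `i` with `i / r > θ`. There
the cross term is already `O(ω^{i/r})` with `i / r > 1`, so sewing from zero produces a level of the
right order, which equals that of `Y` by uniqueness. -/
theorem IsChen.levelControlled_of_min [CompleteSpace V] (hST : S ≤ T) {ω : Control S T}
    {r θ : ℝ} (hr : 0 < r) (hθ : 1 < θ) {Y : Functional N S T n} (hY : IsChen Y)
    (h : LevelControlled ω (fun i => min ((i : ℝ) / r) θ) Y) :
    LevelControlled ω (fun i => (i : ℝ) / r) Y := by
  induction n with
  | zero => exact levelControlled_zero _ _ _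
  | succ n ih =>
    rw [levelControlled_succ] at h ⊢
    have hY' := isChen_succ.mp hY
    have h' := ih hY'.1 h.1
    refine ⟨h', ?_⟩
    rcases le_total (((n + 1 : ℕ) : ℝ) / r) θ with hle | hle
    · have := h.2
      rwa [min_eq_left hle] at this
    obtain ⟨K, hK, hc⟩ := exists_norm_cross_le (a := ((n + 1 : ℕ) : ℝ) / r) h' h' (by positivity)
      (fun _ _ _ => by positivity) (fun _ _ _ => by positivity)
      (fun i j _ _ hij => by rw [← add_div, ← Nat.cast_add, hij])
    obtain ⟨ψ, hψ, hψX⟩ := exists_chen_append hST (hθ.trans_le hle) hY'.1 (Ξ := fun _ => 0)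
      ⟨K, hK, by simpa only [add_zero, zero_add, sub_zero] using hc⟩
    simp only [sub_zero] at hψX
    have h₂ := h.2
    rw [min_eq_right hle] at h₂
    have e : append (trunc (Nat.le_succ n) Y) ψ = Y := by
      refine hψ.eq_of_sub_controlled hST hθ (ω := ω) hY (levelControlled_succ.mpr ⟨?_, ?_⟩)
      · have : trunc (Nat.le_succ n) (append (trunc (Nat.le_succ n) Y) ψ - Y) = fun _ _ => 0 := by
          have e₁ := trunc_append (trunc (Nat.le_succ n) Y) ψ
          exact sub_eq_zero.mpr e₁
        rw [this]
        exact fun i _ => ControlledBy.zero _ _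
      · have : top (append (trunc (Nat.le_succ n) Y) ψ - Y) = fun q => ψ q - top Y q := by
          conv_rhs => rw [← top_append (trunc (Nat.le_succ n) Y) ψ]
          rfl
        rw [this]
        exact (hψX.mono_exponent (by linarith) hle).sub h₂
    rw [← e, top_append]
    exact hψX

/-- The estimate is uniform in the first interval and small in the second; continuity of `t ↦
Y_{S,t}` needs exactly this. -/
theorem exists_norm_cross_le_right {ω : Control S T} {a : ℝ} {X Y : Functional N S T n}
    (hX : LevelControlled ω (fun _ => 0) X) (hY : LevelControlled ω (fun _ => a) Y) :
    ∃ K : ℝ, 0 ≤ K ∧ ∀ q q', ‖cross (X q) (Y q')‖ ≤ K * ω q' ^ a := by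
  obtain ⟨K, hK, hX⟩ := hX.exists_bound
  obtain ⟨K', hK', hY⟩ := hY.exists_bound
  refine ⟨∑ _i : Fin n, K * K', Finset.sum_nonneg fun _ _ => mul_nonneg hK hK', fun q q' =>
    (norm_cross_le _ _).trans ?_⟩
  rw [Finset.sum_mul]
  refine Finset.sum_le_sum fun i _ => ?_
  have h₁ := hX ⟨i + 1, by omega⟩ (by simp) q
  have h₂ := hY ⟨n + 1 - ((i : ℕ) + 1), by omega⟩ (by simp only; omega) q'
  rw [Real.rpow_zero, mul_one] at h₁
  rw [mul_assoc]
  exact mul_le_mul h₁ h₂ (norm_nonneg _) hK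

theorem continuous_cross {X : Type*} [TopologicalSpace X] {a b : X → Trunc N n}
    (ha : Continuous a) (hb : Continuous b) : Continuous fun x => cross (a x) (b x) := by
  refine continuous_finsetSum _ fun i _ => ?_
  have h₁ : Continuous fun x => a x ⟨i + 1, by omega⟩ := (continuous_apply _).comp ha
  have h₂ : Continuous fun x => b x ⟨n + 1 - ((i : ℕ) + 1), by omega⟩ :=
    (continuous_apply _).comp hb
  exact ((N.mul _).continuous.comp h₁).clm_apply h₂

/-- Chen's identity on `S ≤ s ≤ t` expresses the top level at `(s, t)` through the path `t ↦
Y^{n+1}_{S,t}` and lower degrees. The increments of that path are `O(ω^ε)`, so no continuity has to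
be assumed. -/
theorem IsChen.continuous (hST : S ≤ T) {ω : Control S T} {ε : ℝ} (hε : 0 < ε)
    {Y : Functional N S T n} (hY : IsChen Y) (h : LevelControlled ω (fun _ => ε) Y) :
    Continuous Y := by
  induction n with
  | zero =>
    rw [isChen_zero_iff.mp hY]
    exact continuous_const
  | succ n ih =>
    rw [levelControlled_succ] at h
    have hY' := isChen_succ.mp hY
    have hc := ih hY'.1 h.1
    have hS : ∀ t : Set.Icc S T, (⟨S, Set.left_mem_Icc.mpr hST⟩ : Set.Icc S T) ≤ t :=
      fun t => t.2.1
    have hp : Continuous fun q : Simplex S T => pt (hS q.1.1) := by fun_prop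
    have hcross : Continuous fun q : Simplex S T =>
        cross (trunc (Nat.le_succ n) Y (pt (hS q.1.1))) (trunc (Nat.le_succ n) Y q) :=
      continuous_cross (hc.comp hp) hc
    have key : ∀ q : Simplex S T, top Y q = top Y (pt (hS q.1.2)) - top Y (pt (hS q.1.1)) -
        cross (trunc (Nat.le_succ n) Y (pt (hS q.1.1))) (trunc (Nat.le_succ n) Y q) := by
      intro q
      rw [← hY'.2 _ q.1.1 q.1.2 (hS q.1.1) q.2]
      abel
    have htop : Continuous (top Y) := by
      obtain ⟨K, hK, h₁⟩ := exists_norm_cross_le_right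
        (levelControlled_const_zero_of h.1 fun _ _ _ => hε.le) h.1
      obtain ⟨K', hK', h₂⟩ := h.2
      have hV : Continuous fun t => top Y (pt (hS t)) := by
        refine continuous_of_sub_controlled ω hε (add_nonneg hK' hK) fun s t hst => ?_
        rw [← hY'.2 _ s t (hS s) hst, ω.val_of_le hst, add_assoc, add_sub_cancel_left, add_mul]
        refine (norm_add_le _ _).trans (add_le_add (h₂ _) (h₁ _ _))
      rw [funext key]
      exact ((hV.comp (by fun_prop)).sub (hV.comp (by fun_prop))).sub hcross
    refine continuous_pi fun i => ?_
    exact Fin.lastCases (motive := fun i => Continuous fun q => Y q i) htop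
      (fun i => (continuous_apply i).comp hc) i

end RoughPath

namespace RoughPath

variable {V : Type*} [NormedAddCommGroup V] [NormedSpace ℝ V]
variable {N : AdmissibleNorms V} {S T : ℝ} {n : ℕ}

/-! ### Existence and uniqueness of extensions and sewings -/

theorem IsChen.isMultiplicative (hST : S ≤ T) {ω : Control S T} {r : ℝ} (hr : 0 < r)
    {Y : Functional N S T n} (hY : IsChen Y) (h : LevelControlled ω (fun i => (i : ℝ) / r) Y) :
    IsMultiplicative Y := by
  refine ⟨hY.continuous hST (ω := ω) (ε := 1 / r) (by positivity) ?_, hY⟩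
  refine h.mono_exponent (fun _ _ _ => by positivity) fun i hi _ => ?_
  have : (1 : ℝ) ≤ i := by exact_mod_cast hi
  gcongr

/-- The extensions differ only in degree `n + 1`, where the bounds have exponents `(n + 1) / r` and
`(n + 1) / r'`, both above 1. The smaller exponent and the sum of the controls serve for both. -/
theorem IsExt.unique (hST : S ≤ T) {r r' : ℝ} (hr : 1 ≤ r) (hrn : r < (n : ℝ) + 1) (hr' : 1 ≤ r')
    (hrn' : r' < (n : ℝ) + 1) {X : Functional N S T n} {Y Y' : Functional N S T (n + 1)}
    (hY : IsExt r X Y) (hY' : IsExt r' X Y') : Y = Y' := by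
  obtain ⟨hm, ω, hω⟩ := (mem_omega_iff hr).mp hY.1
  obtain ⟨hm', ω', hω'⟩ := (mem_omega_iff hr').mp hY'.1
  have h₁ : 1 < ((n + 1 : ℕ) : ℝ) / r := by
    rw [one_lt_div (by linarith)]; push_cast; exact hrn
  have h₁' : 1 < ((n + 1 : ℕ) : ℝ) / r' := by
    rw [one_lt_div (by linarith)]; push_cast; exact hrn'
  have hθ := lt_min h₁ h₁'
  set θ := min (((n + 1 : ℕ) : ℝ) / r) (((n + 1 : ℕ) : ℝ) / r')
  refine IsChen.eq_of_sub_controlled hST hθ (ω := ω.add ω') hm.2 hm'.2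
    (levelControlled_succ.mpr ⟨?_, ?_⟩)
  · have : trunc (Nat.le_succ n) (Y - Y') = fun _ _ => 0 :=
      sub_eq_zero.mpr (hY.2.trans hY'.2.symm)
    rw [this]
    exact fun i _ => ControlledBy.zero _ _
  · have a := ((levelControlled_succ.mp hω).2.mono_exponent (b := θ) (by linarith)
      (min_le_left _ _)).mono_control (by linarith) (ω.le_add_left ω')
    have b := ((levelControlled_succ.mp hω').2.mono_exponent (b := θ) (by linarith)
      (min_le_right _ _)).mono_control (by linarith) (ω.le_add_right ω')
    exact a.sub b

/-- Sew in degree `n + 1` starting from zero: the defect is the cross term, of order `ω^{(n+1)/r}`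
with exponent above 1. The same bound is inherited by the new level. -/
theorem exists_isExt [CompleteSpace V] (hST : S ≤ T) {r : ℝ} (hr : 1 ≤ r) (hrn : r < (n : ℝ) + 1)
    {ω : Control S T} {X : Functional N S T n} (hX : IsChen X)
    (h : LevelControlled ω (fun i => (i : ℝ) / r) X) :
    ∃ Y, IsExt r X Y ∧ LevelControlled ω (fun i => (i : ℝ) / r) Y := by
  have h₁ : 1 < ((n + 1 : ℕ) : ℝ) / r := by
    rw [one_lt_div (by linarith)]; push_cast; exact hrn
  obtain ⟨K, hK, hc⟩ := exists_norm_cross_le (a := ((n + 1 : ℕ) : ℝ) / r) h h (by positivity)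
    (fun _ _ _ => by positivity) (fun _ _ _ => by positivity)
    (fun i j _ _ hij => by rw [← add_div, ← Nat.cast_add, hij])
  obtain ⟨ψ, hψ, hψX⟩ := exists_chen_append hST h₁ hX (Ξ := fun _ => 0)
    ⟨K, hK, by simpa only [add_zero, zero_add, sub_zero] using hc⟩
  simp only [sub_zero] at hψX
  have hl : LevelControlled ω (fun i => (i : ℝ) / r) (append X ψ) := by
    rw [levelControlled_succ, trunc_append, top_append]
    exact ⟨h, hψX⟩
  exact ⟨append X ψ, ⟨(mem_omega_iff hr).mpr
    ⟨hψ.isMultiplicative hST (by linarith) hl, ω, hl⟩, trunc_append X ψ⟩, hl⟩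

/-- The functional picked by choice may belong to another `r'`; uniqueness across parameters
identifies it with the extension for `r`. -/
theorem isExt_iff_eq_ext [CompleteSpace V] (hST : S ≤ T) {r : ℝ} (hr : 1 ≤ r)
    (hrn : r < (n : ℝ) + 1) {X : Functional N S T n} (hX : X ∈ Omega N S T n r)
    (Y : Functional N S T (n + 1)) : IsExt r X Y ↔ Y = ext X := by
  obtain ⟨hm, ω, hω⟩ := (mem_omega_iff hr).mp hX
  obtain ⟨Z, hZ, -⟩ := exists_isExt hST hr hrn hm.2 hω
  have hex : ∃ Y : Functional N S T (n + 1), ∃ r : ℝ, 1 ≤ r ∧ r < (n : ℝ) + 1 ∧ IsExt r X Y :=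
    ⟨Z, r, hr, hrn, hZ⟩
  obtain ⟨r', hr', hrn', h'⟩ := Classical.epsilon_spec hex
  have e : Z = ext X := hZ.unique hST hr hrn hr' hrn' h'
  constructor
  · intro hY
    rw [← e]
    exact hY.unique hST hr hrn hr hrn hZ
  · rintro rfl
    rwa [← e]

theorem extWellDefined_of_mem_omega [CompleteSpace V] (hST : S ≤ T) {r : ℝ} (hr : 1 ≤ r)
    (hrn : r < (n : ℝ) + 1) {X : Functional N S T n} (hX : X ∈ Omega N S T n r) :
    ExtWellDefined X :=
  ⟨⟨r, hr, hrn, hX⟩, fun _ hr hrn hX Y => isExt_iff_eq_ext hST hr hrn hX Y⟩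

theorem levelControlled_ext [CompleteSpace V] (hST : S ≤ T) {r : ℝ} (hr : 1 ≤ r)
    (hrn : r < (n : ℝ) + 1) {ω : Control S T} {X : Functional N S T n} (hX : IsChen X)
    (h : LevelControlled ω (fun i => (i : ℝ) / r) X) :
    LevelControlled ω (fun i => (i : ℝ) / r) (ext X) := by
  obtain ⟨Y, hY, hl⟩ := exists_isExt hST hr hrn hX h
  have hmem : X ∈ Omega N S T n r :=
    (mem_omega_iff hr).mpr ⟨hX.isMultiplicative hST (by linarith) h, ω, h⟩
  rwa [← (isExt_iff_eq_ext hST hr hrn hmem Y).mp hY]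

theorem IsSewing.unique (hST : S ≤ T) {r r' θ θ' : ℝ} {ω ω' : Control S T}
    (hθ : 1 < θ) (hθ' : 1 < θ') {X Y Y' : Functional N S T n}
    (hY : IsSewing r θ ω X Y) (hY' : IsSewing r' θ' ω' X Y') : Y = Y' := by
  have key : ∀ {r θ : ℝ} {ω : Control S T} {Y : Functional N S T n}, IsSewing r θ ω X Y →
      IsChen Y ∧ LevelControlled ω (fun _ => θ) (Y - X) := by
    rintro r θ ω Y ⟨⟨_, _, _, hm, _⟩, K, hK⟩
    -- The constant in `IsSewing` carries no sign condition, hence the maximum with zero.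
    refine ⟨hm.2, fun i hi => ⟨max K 0, le_max_right _ _, fun q => (hK i hi q).trans ?_⟩⟩
    exact mul_le_mul_of_nonneg_right (le_max_left _ _) (Real.rpow_nonneg (ω.nonneg q) _)
  obtain ⟨hc, h⟩ := key hY
  obtain ⟨hc', h'⟩ := key hY'
  have hmin := lt_min hθ hθ'
  refine IsChen.eq_of_sub_controlled hST hmin (ω := ω.add ω') hc hc' ?_
  have a := (h.mono_exponent (f := fun _ => min θ θ') (fun _ _ _ => by linarith)
    (fun _ _ _ => min_le_left _ _)).mono_control (fun _ _ _ => by linarith) (ω.le_add_left ω')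
  have b := (h'.mono_exponent (f := fun _ => min θ θ') (fun _ _ _ => by linarith)
    (fun _ _ _ => min_le_right _ _)).mono_control (fun _ _ _ => by linarith) (ω.le_add_right ω')
  have := a.sub b
  rwa [sub_sub_sub_cancel_right] at this

theorem exists_isSewing [CompleteSpace V] (hST : S ≤ T) {r θ : ℝ} {ω : Control S T} (hr : 1 ≤ r)
    (hθ : 1 < θ) {X : Functional N S T n} (hX : X ∈ OmegaAm N S T n r θ ω) :
    ∃ Y, IsSewing r θ ω X Y := by
  obtain ⟨K, hK, h₀, hmul, hv⟩ := hX
  have hl := (hasPVariation_iff hr ω X).mp ⟨K, hK, hv⟩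
  have hr0 : 0 < r := by linarith
  obtain ⟨Y, hY, hYX⟩ := exists_chen_near hST hθ hK h₀
    (levelControlled_const_zero_of hl fun _ _ _ => by positivity) hmul
  have hYl : LevelControlled ω (fun i => min ((i : ℝ) / r) θ) Y := by
    have := (hYX.mono_exponent (f := fun i => min ((i : ℝ) / r) θ) (fun _ _ _ => by positivity)
      (fun _ _ _ => min_le_right _ _)).add (hl.mono_exponent (f := fun i => min ((i : ℝ) / r) θ)
      (fun _ _ _ => by positivity) (fun _ _ _ => min_le_left _ _))
    rwa [sub_add_cancel] at this
  have hYr := hY.levelControlled_of_min hST hr0 hθ hYl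
  obtain ⟨C, -, hC⟩ := hYX.exists_bound
  exact ⟨Y, (mem_omega_iff hr).mpr ⟨hY.isMultiplicative hST hr0 hYr, ω, hYr⟩, C, hC⟩

theorem isSewing_iff_eq_sewing [CompleteSpace V] (hST : S ≤ T) {r θ : ℝ} {ω : Control S T}
    (hr : 1 ≤ r) (hθ : 1 < θ) {X : Functional N S T n} (hX : X ∈ OmegaAm N S T n r θ ω)
    (Y : Functional N S T n) : IsSewing r θ ω X Y ↔ Y = sewing X := by
  obtain ⟨Z, hZ⟩ := exists_isSewing hST hr hθ hX
  have hex : ∃ Y : Functional N S T n, ∃ (p θ : ℝ) (ω : Control S T), 1 ≤ p ∧ 1 < θ ∧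
    X ∈ OmegaAm N S T n p θ ω ∧ IsSewing p θ ω X Y := ⟨Z, r, θ, ω, hr, hθ, hX, hZ⟩
  obtain ⟨_, θ', _, -, hθ', -, h'⟩ := Classical.epsilon_spec hex
  have e : Z = sewing X := hZ.unique hST hθ hθ' h'
  constructor
  · intro hY
    rw [← e]
    exact hY.unique hST hθ hθ hZ
  · rintro rfl
    rwa [← e]

theorem sewingWellDefined_of_mem_omegaAm [CompleteSpace V] (hST : S ≤ T) {p θ : ℝ}
    {ω : Control S T} (hθ : 1 < θ) {X : Functional N S T n} (hX : X ∈ OmegaAm N S T n p θ ω) :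
    SewingWellDefined p X :=
  ⟨⟨θ, ω, hθ, hX⟩, fun _ _ _ hr hθ hX Y => isSewing_iff_eq_sewing hST hr hθ hX Y⟩

end RoughPath

namespace RoughPath

variable {V : Type*} [NormedAddCommGroup V] [NormedSpace ℝ V]
variable {N : AdmissibleNorms V} {S T : ℝ} {n : ℕ}

/-! ### The lift and the development -/

/-- The growth condition shared by `𝓗^{(n,p)}` and `𝔍^{(n,p)}`, for a fixed control and a fixed
exponent. -/
def HasGrowth (p φ : ℝ) (ω : Control S T) (X : Functional N S T n) : Prop :=
  LevelControlled ω (fun _ => φ) X ∧ (n = ⌊p⌋₊ → ControlledBy ω ((n : ℝ) / p) (top X))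

theorem nonneg_of_mem_Ioc {p φ : ℝ} (hp : 1 ≤ p) (hφ : φ ∈ Set.Ioc (1 - 1 / p) 1) : 0 < φ := by
  have : 1 / p ≤ 1 := by rw [div_le_one (by linarith)]; exact hp
  linarith [hφ.1]

theorem natCast_div_le_one {p : ℝ} (hp : 1 ≤ p) {i : ℕ} (hi : i ≤ ⌊p⌋₊) : (i : ℝ) / p ≤ 1 := by
  rw [div_le_one (by linarith)]
  exact (Nat.le_floor_iff (by linarith)).mp hi

theorem natCast_div_le_of_lt_floor {p φ : ℝ} (hp : 1 ≤ p) (hφ : φ ∈ Set.Ioc (1 - 1 / p) 1) {i : ℕ}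
    (hi : i < ⌊p⌋₊) : (i : ℝ) / p ≤ φ := by
  have := natCast_div_le_one hp (Nat.succ_le_of_lt hi)
  push_cast [Nat.succ_eq_add_one] at this
  rw [add_div] at this
  linarith [hφ.1]

/-- For `i < ⌊p⌋` one has `i / p ≤ 1 - 1/p < φ`, so the bound by `ω^φ` already gives finite
`p`-variation; only degree `⌊p⌋` needs the extra condition. -/
theorem HasGrowth.levelControlled {p φ : ℝ} (hp : 1 ≤ p) (hφ : φ ∈ Set.Ioc (1 - 1 / p) 1)
    (hn : n ≤ ⌊p⌋₊) {ω : Control S T} {X : Functional N S T n} (h : HasGrowth p φ ω X) :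
    LevelControlled ω (fun i => (i : ℝ) / p) X := by
  intro i hi
  have hin : (i : ℕ) ≤ n := Nat.lt_succ_iff.mp i.2
  by_cases hip : (i : ℕ) = ⌊p⌋₊
  · obtain rfl : i = Fin.last n := Fin.ext (by simp only [Fin.val_last]; omega)
    exact h.2 hip
  · exact (h.1 i hi).mono_exponent (by positivity)
      (natCast_div_le_of_lt_floor hp hφ (by omega))

theorem HasGrowth.mono {p φ φ' : ℝ} (hp : 0 ≤ p) (hφ' : 0 ≤ φ') (hφφ' : φ' ≤ φ)
    {ω ω' : Control S T} (hω : ∀ q, ω q ≤ ω' q) {X : Functional N S T n}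
    (h : HasGrowth p φ ω X) : HasGrowth p φ' ω' X :=
  ⟨(h.1.mono_exponent (fun _ _ _ => hφ') fun _ _ _ => hφφ').mono_control (fun _ _ _ => hφ') hω,
    fun hn => (h.2 hn).mono_control (by positivity) hω⟩

theorem HasGrowth.add {p φ : ℝ} {ω : Control S T} {X Y : Functional N S T n}
    (hX : HasGrowth p φ ω X) (hY : HasGrowth p φ ω Y) : HasGrowth p φ ω (X + Y) :=
  ⟨hX.1.add hY.1, fun hn => (hX.2 hn).add (hY.2 hn)⟩

theorem HasGrowth.smul {p φ : ℝ} {ω : Control S T} {X : Functional N S T n}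
    (hX : HasGrowth p φ ω X) (c : ℝ) : HasGrowth p φ ω (c • X) :=
  ⟨hX.1.smul c, fun hn => (hX.2 hn).smul c⟩

theorem HasGrowth.trunc {p φ : ℝ} {ω : Control S T} {X : Functional N S T (n + 1)}
    (h : HasGrowth p φ ω X) (hn : n + 1 ≤ ⌊p⌋₊) :
    HasGrowth p φ ω (trunc (Nat.le_succ n) X) :=
  ⟨levelControlled_trunc h.1 _, fun h' => by omega⟩

/-- Continuity and the remaining variation bounds follow from Chen's identity and the growth
condition, so these two carry all later arguments. -/
theorem mem_hSpaceK_iff (hST : S ≤ T) {p : ℝ} (hp : 1 ≤ p) (hn1 : 1 ≤ n) (hn : n ≤ ⌊p⌋₊)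
    {H : Functional N S T n} : H ∈ HSpaceK N S T n p ↔ IsChen H ∧ ∃ (ω : Control S T) (φ : ℝ),
      φ ∈ Set.Ioc (1 - 1 / p) 1 ∧ HasGrowth p φ ω H := by
  constructor
  · rintro ⟨hΩ, K, ω, φ, hK, hφ, h⟩
    obtain ⟨hm, ω', hω'⟩ := (mem_omega_iff hp).mp hΩ
    have hl : LevelControlled ω (fun _ => φ) H := fun i hi => ⟨K, hK, h i hi⟩
    refine ⟨hm.2, ω.add ω', φ, hφ, ?_, fun _ => ?_⟩
    · exact hl.mono_control (fun _ _ _ => (nonneg_of_mem_Ioc hp hφ).le) (ω.le_add_left ω')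
    · exact (hω' (Fin.last n) hn1).mono_control (by positivity) (ω.le_add_right ω')
  · rintro ⟨hc, ω, φ, hφ, h⟩
    have hl := h.levelControlled hp hφ hn
    obtain ⟨K, hK, hb⟩ := h.1.exists_bound
    exact ⟨(mem_omega_iff hp).mpr ⟨hc.isMultiplicative hST (by linarith) hl, ω, hl⟩,
      K, ω, φ, hK, hφ, hb⟩

/-- Additive functionals with vanishing component of degree zero. -/
def IsAdditiveZero (I : Functional N S T n) : Prop :=
  (∀ q, I q 0 = 0) ∧ IsAdditive I

theorem mem_iSpaceK_iff {p : ℝ} {I : Functional N S T n} :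
    I ∈ ISpaceK N S T n p ↔ IsAdditiveZero I ∧ ∃ (ω : Control S T) (φ : ℝ),
      φ ∈ Set.Ioc (1 - 1 / p) 1 ∧ HasGrowth p φ ω I := by
  constructor
  · rintro ⟨h₀, ha, K, ω, φ, hK, hφ, h, h'⟩
    exact ⟨⟨h₀, ha⟩, ω, φ, hφ, fun i hi => ⟨K, hK, h i hi⟩, fun hn => ⟨K, hK, h' hn⟩⟩
  · rintro ⟨⟨h₀, ha⟩, ω, φ, hφ, h, h'⟩
    obtain ⟨K, hK, hb⟩ := h.exists_bound
    by_cases hn : n = ⌊p⌋₊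
    · obtain ⟨K', hK', hb'⟩ := h' hn
      refine ⟨h₀, ha, max K K', ω, φ, le_max_of_le_left hK, hφ, fun i hi q => ?_, fun _ q => ?_⟩
      · exact (hb i hi q).trans (mul_le_mul_of_nonneg_right (le_max_left _ _)
          (Real.rpow_nonneg (ω.nonneg q) _))
      · exact (hb' q).trans (mul_le_mul_of_nonneg_right (le_max_right _ _)
          (Real.rpow_nonneg (ω.nonneg q) _))
    · exact ⟨h₀, ha, K, ω, φ, hK, hφ, hb, fun hn' => absurd hn' hn⟩

theorem exists_common_growth {m : ℕ} {p φ φ' : ℝ} (hp : 1 ≤ p) (hφ : φ ∈ Set.Ioc (1 - 1 / p) 1)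
    (hφ' : φ' ∈ Set.Ioc (1 - 1 / p) 1) {ω ω' : Control S T} {X : Functional N S T n}
    {Y : Functional N S T m} (hX : HasGrowth p φ ω X) (hY : HasGrowth p φ' ω' Y) :
    ∃ (ω'' : Control S T) (φ'' : ℝ), φ'' ∈ Set.Ioc (1 - 1 / p) 1 ∧
      HasGrowth p φ'' ω'' X ∧ HasGrowth p φ'' ω'' Y := by
  have h : min φ φ' ∈ Set.Ioc (1 - 1 / p) 1 :=
    ⟨lt_min hφ.1 hφ'.1, (min_le_left _ _).trans hφ.2⟩
  have h₀ := (nonneg_of_mem_Ioc hp h).le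
  exact ⟨ω.add ω', min φ φ', h, hX.mono (by linarith) h₀ (min_le_left _ _) (ω.le_add_left ω'),
    hY.mono (by linarith) h₀ (min_le_right _ _) (ω.le_add_right ω')⟩

theorem isAdditiveZero_succ {I : Functional N S T (n + 1)} :
    IsAdditiveZero I ↔ IsAdditiveZero (trunc (Nat.le_succ n) I) ∧
      ∀ (s u t : Set.Icc S T) (hsu : s ≤ u) (hut : u ≤ t),
        top I (pt hsu) + top I (pt hut) = top I (pt (hsu.trans hut)) := by
  constructor
  · rintro ⟨h₀, h⟩
    exact ⟨⟨h₀, fun s u t hsu hut => congrArg initComp (h s u t hsu hut)⟩,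
      fun s u t hsu hut => congrArg lastComp (h s u t hsu hut)⟩
  · rintro ⟨⟨h₀, h⟩, h'⟩
    exact ⟨h₀, fun s u t hsu hut => ext_initComp_lastComp (h s u t hsu hut) (h' s u t hsu hut)⟩

theorem hasGrowth_succ {p φ : ℝ} {ω : Control S T} {X : Functional N S T (n + 1)}
    (h : LevelControlled ω (fun _ => φ) (trunc (Nat.le_succ n) X))
    (h₁ : ControlledBy ω φ (top X))
    (h₂ : n + 1 = ⌊p⌋₊ → ControlledBy ω (((n + 1 : ℕ) : ℝ) / p) (top X)) : HasGrowth p φ ω X :=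
  ⟨levelControlled_succ.mpr ⟨h, h₁⟩, h₂⟩

/-- The extension of a functional whose components are all `O(ω^φ)`. -/
theorem ext_of_levelControlled [CompleteSpace V] (hST : S ≤ T) {p φ : ℝ} (hp : 1 ≤ p)
    (hφ : φ ∈ Set.Ioc (1 - 1 / p) 1) (hn1 : 1 ≤ n) (hn : n + 1 ≤ ⌊p⌋₊) {ω : Control S T}
    {X : Functional N S T n} (hX : IsChen X) (h : LevelControlled ω (fun _ => φ) X) :
    ExtWellDefined X ∧ IsChen (ext X) ∧ trunc (Nat.le_succ n) (ext X) = X ∧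
      ControlledBy ω (φ + 1 / p) (top (ext X)) := by
  have hφ0 := nonneg_of_mem_Ioc hp hφ
  have hn0 : (0 : ℝ) < n := by exact_mod_cast hn1
  have hp0 : 0 < p := by linarith
  have hnp : (n : ℝ) + 1 ≤ p := by exact_mod_cast (Nat.le_floor_iff (by linarith)).mp hn
  -- From `φ > 1 - 1/p` follows `φ p > p - 1 ≥ n`.
  have hφn : 1 / p ≤ φ / n := by
    have h₁ := hφ.1
    rw [div_le_div_iff₀ hp0 hn0]
    have h₂ : (1 - 1 / p) * p = p - 1 := by field_simp
    have h₃ : (1 - 1 / p) * p ≤ φ * p := mul_le_mul_of_nonneg_right h₁.le hp0.le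
    linarith
  -- The effective variation index is `r = n / φ`, since `i / r = iφ/n ≤ φ` for `i ≤ n`. It lies
  -- below `n + 1` because `φ > 1 - 1/p ≥ n / (n + 1)`.
  have hr : 1 ≤ (n : ℝ) / φ := by
    rw [le_div_iff₀ hφ0, one_mul]
    exact hφ.2.trans (by exact_mod_cast hn1)
  have hrn : (n : ℝ) / φ < n + 1 := by
    rw [div_lt_iff₀ hφ0]
    have h₁ : 1 / p ≤ 1 / ((n : ℝ) + 1) := one_div_le_one_div_of_le (by positivity) hnp
    have h₂ : ((n : ℝ) + 1) * (1 - 1 / ((n : ℝ) + 1)) = n := by field_simp; ring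
    have h₃ : 1 - 1 / ((n : ℝ) + 1) < φ := by linarith [hφ.1]
    rw [mul_comm]
    rw [mul_comm] at h₂
    nlinarith
  have hl : LevelControlled ω (fun i => (i : ℝ) / (n / φ)) X := by
    refine h.mono_exponent (fun _ _ _ => by positivity) fun i _ hi => ?_
    have : (i : ℝ) ≤ n := by exact_mod_cast hi
    rw [div_div_eq_mul_div, div_le_iff₀ hn0]
    nlinarith
  have hmem : X ∈ Omega N S T n (n / φ) :=
    (mem_omega_iff hr).mpr ⟨hX.isMultiplicative hST (by positivity) hl, ω, hl⟩
  have hext := (isExt_iff_eq_ext hST hr hrn hmem (ext X)).mpr rfl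
  refine ⟨extWellDefined_of_mem_omega hST hr hrn hmem, ((mem_omega_iff hr).mp hext.1).1.2,
    hext.2, ?_⟩
  refine (levelControlled_succ.mp (levelControlled_ext hST hr hrn hX hl)).2.mono_exponent
    (by positivity) ?_
  -- The exponent of the new level is `(n + 1)φ/n = φ + φ/n ≥ φ + 1/p`.
  rw [div_div_eq_mul_div, Nat.cast_add, Nat.cast_one, add_mul, one_mul, add_div,
    mul_div_cancel_left₀ _ hn0.ne']
  linarith

theorem one_lt_add_one_div {p φ : ℝ} (hφ : φ ∈ Set.Ioc (1 - 1 / p) 1) : 1 < φ + 1 / p := by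
  linarith [hφ.1]

@[simp]
theorem trunc_add {m : ℕ} (h : m ≤ n) (X Y : Functional N S T n) :
    trunc h (X + Y) = trunc h X + trunc h Y :=
  rfl

@[simp]
theorem top_add (X Y : Functional N S T n) : top (X + Y) = top X + top Y :=
  rfl

theorem trunc_lift_succ [CompleteSpace V] {I : Functional N S T (n + 2)}
    (h : trunc (Nat.le_succ (n + 1)) (ext (lift (trunc (Nat.le_succ (n + 1)) I))) =
      lift (trunc (Nat.le_succ (n + 1)) I)) :
    trunc (Nat.le_succ (n + 1)) (lift I) = lift (trunc (Nat.le_succ (n + 1)) I) := by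
  rw [lift, trunc_add, trunc_append, h, add_zero]

theorem top_lift_succ (I : Functional N S T (n + 2)) :
    top (lift I) = top (ext (lift (trunc (Nat.le_succ (n + 1)) I))) + top I := by
  rw [lift, top_add, top_append]

/-- For a fixed control and exponent, `lift` maps additive functionals to multiplicative ones,
and `dev` inverts it. -/
theorem lift_spec [CompleteSpace V] (hST : S ≤ T) {p φ : ℝ} (hp : 1 ≤ p)
    (hφ : φ ∈ Set.Ioc (1 - 1 / p) 1) (hn : n + 1 ≤ ⌊p⌋₊) {ω : Control S T}
    {I : Functional N S T (n + 1)} (hI : IsAdditiveZero I) (hg : HasGrowth p φ ω I) :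
    IsChen (lift I) ∧ HasGrowth p φ ω (lift I) ∧ dev (lift I) = I := by
  induction n with
  | zero =>
    rw [isAdditiveZero_succ] at hI
    have htr : trunc (Nat.le_succ 0) (lift I) = one N S T 0 := trunc_append _ _
    have htop : top (lift I) = top I := top_append _ _
    refine ⟨isChen_succ.mpr ⟨?_, fun s u t hsu hut => ?_⟩, hasGrowth_succ ?_ ?_ ?_, ?_⟩
    · rw [htr]
      exact isChen_zero_iff.mpr rfl
    · rw [htop]
      exact (add_zero _).trans (hI.2 s u t hsu hut)
    · exact levelControlled_zero _ _ _
    · rw [htop]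
      exact (levelControlled_succ.mp hg.1).2
    · rw [htop]
      exact hg.2
    · refine functional_ext ?_ ?_
      · refine (trunc_append _ _).trans ?_
        funext q i
        obtain rfl : i = 0 := Fin.fin_one_eq_zero i
        exact (hI.1.1 q).symm
      · exact (top_append _ _).trans htop
  | succ n ih =>
    rw [isAdditiveZero_succ] at hI
    obtain ⟨hc, hgl, hdev⟩ := ih (by omega) hI.1 (hg.trunc hn)
    obtain ⟨-, hce, htr, hte⟩ := ext_of_levelControlled hST hp hφ (by omega) hn hc hgl.1
    have htr' := trunc_lift_succ htr
    have htop := top_lift_succ I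
    have h1 := one_lt_add_one_div hφ
    have hφ0 := nonneg_of_mem_Ioc hp hφ
    refine ⟨isChen_succ.mpr ⟨?_, fun s u t hsu hut => ?_⟩, hasGrowth_succ ?_ ?_ ?_, ?_⟩
    · rwa [htr']
    -- The extension already satisfies Chen's identity over the same lower degrees; adding an
    -- additive top level preserves it.
    · have h := (isChen_succ.mp hce).2 s u t hsu hut
      rw [htr] at h
      rw [htr', htop]
      simp only [Pi.add_apply]
      rw [← h, ← hI.2 s u t hsu hut]
      abel
    · rw [htr']
      exact hgl.1
    · rw [htop]
      exact (hte.mono_exponent hφ0.le (by linarith [hφ.2])).add (levelControlled_succ.mp hg.1).2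
    · intro h
      rw [htop]
      exact (hte.mono_exponent (by positivity)
        ((natCast_div_le_one hp hn).trans h1.le)).add (hg.2 h)
    · refine functional_ext ?_ ?_
      · rw [dev, trunc_append, htr', hdev]
      · rw [dev, top_append, htr', htop, add_sub_cancel_left]

/-- `H` and the extension of its truncation share their lower degrees, hence their cross terms, so
the difference of their top levels is additive. The subtracted level has exponent above 1 and harms
neither growth bound. -/
theorem dev_spec [CompleteSpace V] (hST : S ≤ T) {p φ : ℝ} (hp : 1 ≤ p)
    (hφ : φ ∈ Set.Ioc (1 - 1 / p) 1) (hn : n + 1 ≤ ⌊p⌋₊) {ω : Control S T}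
    {H : Functional N S T (n + 1)} (hH : IsChen H) (hg : HasGrowth p φ ω H) :
    IsAdditiveZero (dev H) ∧ HasGrowth p φ ω (dev H) ∧ lift (dev H) = H := by
  induction n with
  | zero =>
    rw [isChen_succ] at hH
    have htr : trunc (Nat.le_succ 0) (dev H) = 0 := trunc_append _ _
    have htop : top (dev H) = top H := top_append _ _
    refine ⟨isAdditiveZero_succ.mpr ⟨?_, fun s u t hsu hut => ?_⟩, hasGrowth_succ ?_ ?_ ?_, ?_⟩
    · rw [htr]
      exact ⟨fun _ => rfl, fun _ _ _ _ _ => add_zero _⟩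
    · rw [htop]
      exact (add_zero _).symm.trans (hH.2 s u t hsu hut)
    · exact levelControlled_zero _ _ _
    · rw [htop]
      exact (levelControlled_succ.mp hg.1).2
    · rw [htop]
      exact hg.2
    · refine functional_ext ?_ ?_
      · exact (trunc_append _ _).trans (isChen_zero_iff.mp hH.1).symm
      · exact (top_append _ _).trans htop
  | succ n ih =>
    rw [isChen_succ] at hH
    obtain ⟨ha, hgd, hlift⟩ := ih (by omega) hH.1 (hg.trunc hn)
    obtain ⟨-, hce, htr, hte⟩ := ext_of_levelControlled hST hp hφ (by omega) hn hH.1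
      (hg.trunc hn).1
    have h1 := one_lt_add_one_div hφ
    have hφ0 := nonneg_of_mem_Ioc hp hφ
    have htr' : trunc (Nat.le_succ (n + 1)) (dev H) = dev (trunc (Nat.le_succ (n + 1)) H) :=
      trunc_append _ _
    have htop : top (dev H) = top H - top (ext (trunc (Nat.le_succ (n + 1)) H)) :=
      top_append _ _
    refine ⟨isAdditiveZero_succ.mpr ⟨?_, fun s u t hsu hut => ?_⟩, hasGrowth_succ ?_ ?_ ?_, ?_⟩
    · rwa [htr']
    · have h := (isChen_succ.mp hce).2 s u t hsu hut
      rw [htr] at h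
      rw [htop]
      simp only [Pi.sub_apply]
      rw [← h, ← hH.2 s u t hsu hut]
      abel
    · rw [htr']
      exact hgd.1
    · rw [htop]
      exact (levelControlled_succ.mp hg.1).2.sub (hte.mono_exponent hφ0.le (by linarith [hφ.2]))
    · intro h
      rw [htop]
      exact (hg.2 h).sub (hte.mono_exponent (by positivity)
        ((natCast_div_le_one hp hn).trans h1.le))
    · refine functional_ext ?_ ?_
      · rw [trunc_lift_succ, htr', hlift]
        rw [htr', hlift, htr]
      · rw [top_lift_succ, htr', hlift, htop, add_sub_cancel]

/-! ### The sewing of a sum of lifts -/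

theorem trunc_oplus {m : ℕ} (h : m ≤ n) (X Y : Functional N S T n) :
    trunc h (oplus X Y) = oplus (trunc h X) (trunc h Y) := by
  funext q i
  refine congrArg (X q (Fin.castLE (Nat.succ_le_succ h) i) +
    Y q (Fin.castLE (Nat.succ_le_succ h) i) - ·) ?_
  exact Fin.cases (motive := fun i => unit N n (Fin.castLE (Nat.succ_le_succ h) i) = unit N m i)
    rfl (fun _ => rfl) i

theorem top_oplus (X Y : Functional N S T (n + 1)) : top (oplus X Y) = top X + top Y :=
  funext fun q => sub_zero (top X q + top Y q)

theorem levelControlled_oplus {ω : Control S T} {e : ℕ → ℝ} {X Y : Functional N S T n}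
    (hX : LevelControlled ω e X) (hY : LevelControlled ω e Y) :
    LevelControlled ω e (oplus X Y) := by
  refine (hX.add hY).sub fun i hi => ?_
  obtain ⟨j, rfl⟩ := Fin.exists_succ_eq.mpr (show i ≠ 0 by rintro rfl; simp at hi)
  exact ControlledBy.zero _ _

theorem oplus_zero_apply {X Y : Functional N S T n} (hX : IsChen X) (hY : IsChen Y)
    (q : Simplex S T) : oplus X Y q 0 = scalarOne N := by
  have h : ∀ x y z : N.Pow 0, x = z → y = z → x + y - z = z := by
    rintro x y z rfl rfl
    exact add_sub_cancel_right _ _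
  exact h _ _ _ (hX.1 q) (hY.1 q)

theorem cross_unit_left (m : ℕ) (b : Trunc N m) : cross (unit N m) b = 0 := by
  refine Finset.sum_eq_zero fun i _ => ?_
  have h : unit N m ⟨i + 1, by omega⟩ = 0 := rfl
  rw [h, map_zero]
  rfl

theorem cross_unit_right (m : ℕ) (a : Trunc N m) : cross a (unit N m) = 0 := by
  refine Finset.sum_eq_zero fun i _ => ?_
  have h : ∀ (j : ℕ) (hj : j < m + 1), 0 < j → unit N m ⟨j, hj⟩ = 0 := by
    rintro (_ | j) hj h
    · omega
    · rfl
  rw [h _ _ (by omega), map_zero]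

theorem cross_oplus (X Y : Functional N S T n) (q q' : Simplex S T) :
    cross (oplus X Y q) (oplus X Y q') =
      cross (X q) (X q') + cross (X q) (Y q') + cross (Y q) (X q') + cross (Y q) (Y q') := by
  have e : ∀ q, oplus X Y q + unit N n = X q + Y q := fun q => sub_add_cancel _ _
  have h : cross (oplus X Y q + unit N n) (oplus X Y q' + unit N n) =
      cross (oplus X Y q) (oplus X Y q') := by
    rw [cross_add_left, cross_add_right, cross_unit_left, cross_unit_right, add_zero, add_zero]
  rw [← h, e, e, cross_add_left, cross_add_right, cross_add_right]
  abel

/-- The pure terms cancel by Chen's identity for `X` and `Y`; what remains in each degree are the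
mixed cross terms, of order `ω^{2φ}`. -/
theorem exists_tmul_oplus_sub_le {p φ : ℝ} (hp : 1 ≤ p) (hφ : φ ∈ Set.Ioc (1 - 1 / p) 1)
    (hn : n ≤ ⌊p⌋₊) {ω : Control S T} {X Y : Functional N S T n} (hX : IsChen X) (hY : IsChen Y)
    (hXl : LevelControlled ω (fun _ => φ) X) (hYl : LevelControlled ω (fun _ => φ) Y) :
    ∃ K : ℝ, 0 ≤ K ∧ ∀ (s u t : Set.Icc S T) (hsu : s ≤ u) (hut : u ≤ t) (i : Fin (n + 1)),
      1 ≤ (i : ℕ) → ‖tmul (oplus X Y (pt hsu)) (oplus X Y (pt hut)) i -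
        oplus X Y (pt (hsu.trans hut)) i‖ ≤ K * ω (pt (hsu.trans hut)) ^ (φ + 1 / p) := by
  induction n with
  | zero => exact ⟨0, le_rfl, fun _ _ _ _ _ i hi => by omega⟩
  | succ n ih =>
    have hφ0 := nonneg_of_mem_Ioc hp hφ
    obtain ⟨K, hK, h⟩ := ih (by omega) (isChen_succ.mp hX).1 (isChen_succ.mp hY).1
      (levelControlled_succ.mp hXl).1 (levelControlled_succ.mp hYl).1
    -- Mixed terms occur only from degree 2 on, so `p ≥ 2` and `φ > 1 - 1/p ≥ 1/p`.
    have he : ∀ i j : ℕ, 1 ≤ i → 1 ≤ j → i + j = n + 1 → φ + 1 / p ≤ φ + φ := by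
      intro i j hi hj hij
      have h2 : (2 : ℝ) ≤ p := by
        exact_mod_cast (Nat.le_floor_iff (by linarith)).mp (show 2 ≤ ⌊p⌋₊ by omega)
      have : 1 / p ≤ 1 / 2 := one_div_le_one_div_of_le two_pos h2
      linarith [hφ.1]
    obtain ⟨K₁, hK₁, h₁⟩ := exists_norm_cross_le (a := φ + 1 / p) (levelControlled_succ.mp hXl).1
      (levelControlled_succ.mp hYl).1 (by positivity) (fun _ _ _ => hφ0.le) (fun _ _ _ => hφ0.le)
      he
    obtain ⟨K₂, hK₂, h₂⟩ := exists_norm_cross_le (a := φ + 1 / p) (levelControlled_succ.mp hYl).1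
      (levelControlled_succ.mp hXl).1 (by positivity) (fun _ _ _ => hφ0.le) (fun _ _ _ => hφ0.le)
      he
    refine ⟨max K (K₁ + K₂), le_max_of_le_left hK, fun s u t hsu hut i => ?_⟩
    have hω : 0 ≤ ω (pt (hsu.trans hut)) ^ (φ + 1 / p) := Real.rpow_nonneg (ω.nonneg _) _
    refine Fin.lastCases (motive := fun i => 1 ≤ (i : ℕ) →
      ‖tmul (oplus X Y (pt hsu)) (oplus X Y (pt hut)) i - oplus X Y (pt (hsu.trans hut)) i‖ ≤
        max K (K₁ + K₂) * ω (pt (hsu.trans hut)) ^ (φ + 1 / p)) (fun _ => ?_)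
      (fun i hi => ?_) i
    · have e : lastComp (tmul (oplus X Y (pt hsu)) (oplus X Y (pt hut))) -
          top (oplus X Y) (pt (hsu.trans hut)) =
          cross (trunc (Nat.le_succ n) X (pt hsu)) (trunc (Nat.le_succ n) Y (pt hut)) +
          cross (trunc (Nat.le_succ n) Y (pt hsu)) (trunc (Nat.le_succ n) X (pt hut)) := by
        rw [top_chen (oplus_zero_apply hX hY), trunc_oplus, cross_oplus, top_oplus]
        simp only [Pi.add_apply]
        rw [← (isChen_succ.mp hX).2 s u t hsu hut, ← (isChen_succ.mp hY).2 s u t hsu hut]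
        abel
      refine le_trans (le_of_eq (congrArg _ e)) ((norm_add_le_of_le (h₁ s u t hsu hut)
        (h₂ s u t hsu hut)).trans ?_)
      rw [← add_mul]
      exact mul_le_mul_of_nonneg_right (le_max_right _ _) hω
    · have h' := h s u t hsu hut i hi
      rw [← trunc_oplus] at h'
      exact h'.trans (mul_le_mul_of_nonneg_right (le_max_left _ _) hω)

theorem oplus_mem_omegaAm {p φ : ℝ} (hp : 1 ≤ p) (hφ : φ ∈ Set.Ioc (1 - 1 / p) 1)
    (hn : n ≤ ⌊p⌋₊) {ω : Control S T} {X Y : Functional N S T n} (hX : IsChen X) (hY : IsChen Y)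
    (hXg : HasGrowth p φ ω X) (hYg : HasGrowth p φ ω Y) :
    oplus X Y ∈ OmegaAm N S T n p (φ + 1 / p) ω := by
  obtain ⟨K, hK, h⟩ := exists_tmul_oplus_sub_le hp hφ hn hX hY hXg.1 hYg.1
  obtain ⟨K', hK', h'⟩ := (hasPVariation_iff hp ω _).mpr
    (levelControlled_oplus (hXg.levelControlled hp hφ hn) (hYg.levelControlled hp hφ hn))
  refine ⟨max K K', le_max_of_le_left hK, oplus_zero_apply hX hY, fun s u t hsu hut i hi => ?_,
    fun i hi q => ?_⟩
  · exact (h s u t hsu hut i hi).trans (mul_le_mul_of_nonneg_right (le_max_left _ _)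
      (Real.rpow_nonneg (ω.nonneg _) _))
  · refine (h' i hi q).trans (mul_le_mul_of_nonneg_right (le_max_right _ _) ?_)
    exact div_nonneg (Real.rpow_nonneg (ω.nonneg _) _)
      (mul_nonneg (by linarith [one_le_beta hp]) (Real.Gamma_pos_of_pos (by positivity)).le)

/-- From degree 2 on, the top level of a lift differs from its additive datum by the top level of an
extension, which is `O(ω^{φ + 1/p})`; the additive data themselves cancel. In degree 1 the
difference is exactly zero. -/
theorem levelControlled_lift_add_sub_oplus [CompleteSpace V] (hST : S ≤ T) {p φ : ℝ} (hp : 1 ≤ p)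
    (hφ : φ ∈ Set.Ioc (1 - 1 / p) 1) (hn : n + 1 ≤ ⌊p⌋₊) {ω : Control S T}
    {I J : Functional N S T (n + 1)} (hI : IsAdditiveZero I) (hJ : IsAdditiveZero J)
    (hIJ : IsAdditiveZero (I + J)) (hIg : HasGrowth p φ ω I) (hJg : HasGrowth p φ ω J) :
    LevelControlled ω (fun _ => φ + 1 / p) (lift (I + J) - oplus (lift I) (lift J)) := by
  induction n with
  | zero =>
    refine levelControlled_succ.mpr ⟨levelControlled_zero _ _ _, ?_⟩
    have : top (lift (I + J) - oplus (lift I) (lift J)) = fun _ => 0 := by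
      have h : ∀ I : Functional N S T 1, top (lift I) = top I := fun I => top_append _ _
      have : top (lift (I + J)) = top (oplus (lift I) (lift J)) := by
        rw [top_oplus, h, h, h, top_add]
      exact sub_eq_zero.mpr this
    rw [this]
    exact ControlledBy.zero _ _
  | succ n ih =>
    have key : ∀ {I : Functional N S T (n + 2)}, IsAdditiveZero I → HasGrowth p φ ω I →
        trunc (Nat.le_succ (n + 1)) (lift I) = lift (trunc (Nat.le_succ (n + 1)) I) ∧
        ControlledBy ω (φ + 1 / p) (fun q => top (lift I) q - top I q) := by
      intro I hI hg
      obtain ⟨hc, hgl, -⟩ := lift_spec hST hp hφ (by omega) (isAdditiveZero_succ.mp hI).1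
        (hg.trunc hn)
      obtain ⟨-, -, htr, hte⟩ := ext_of_levelControlled hST hp hφ (by omega) hn hc hgl.1
      refine ⟨trunc_lift_succ htr, ?_⟩
      rw [top_lift_succ]
      simpa only [Pi.add_apply, add_sub_cancel_right] using hte
    obtain ⟨h₁, k₁⟩ := key hI hIg
    obtain ⟨h₂, k₂⟩ := key hJ hJg
    obtain ⟨h₃, k₃⟩ := key hIJ (hIg.add hJg)
    refine levelControlled_succ.mpr ⟨?_, ?_⟩
    · have e : trunc (Nat.le_succ (n + 1)) (lift (I + J) - oplus (lift I) (lift J)) =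
          lift (trunc (Nat.le_succ (n + 1)) I + trunc (Nat.le_succ (n + 1)) J) -
          oplus (lift (trunc (Nat.le_succ (n + 1)) I))
            (lift (trunc (Nat.le_succ (n + 1)) J)) := by
        rw [← h₁, ← h₂, ← trunc_oplus, ← trunc_add, ← h₃]
        rfl
      rw [e]
      exact ih (by omega) (isAdditiveZero_succ.mp hI).1 (isAdditiveZero_succ.mp hJ).1
        (isAdditiveZero_succ.mp hIJ).1 (hIg.trunc hn) (hJg.trunc hn)
    · have e : top (lift (I + J) - oplus (lift I) (lift J)) = fun q =>
          top (lift (I + J)) q - top (I + J) q - (top (lift I) q - top I q) -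
            (top (lift J) q - top J q) := by
        have : top (lift (I + J) - oplus (lift I) (lift J)) =
          top (lift (I + J)) - top (oplus (lift I) (lift J)) := rfl
        rw [this, top_oplus, top_add]
        funext q
        simp only [Pi.add_apply, Pi.sub_apply]
        abel
      rw [e]
      exact (k₃.sub k₁).sub k₂

end RoughPath

namespace RoughPath

variable {V : Type*} [NormedAddCommGroup V] [NormedSpace ℝ V]
variable {N : AdmissibleNorms V} {S T : ℝ} {n : ℕ}

/-! ### The vector space structure -/

theorem one_le_floor {p : ℝ} (hp : 1 ≤ p) : 1 ≤ ⌊p⌋₊ :=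
  (Nat.one_le_floor_iff p).mpr hp

theorem mem_hSpaceK_lift [CompleteSpace V] (hST : S ≤ T) {p : ℝ} (hp : 1 ≤ p) (hn1 : 1 ≤ n)
    (hn : n ≤ ⌊p⌋₊) {I : Functional N S T n} (hI : I ∈ ISpaceK N S T n p) :
    lift I ∈ HSpaceK N S T n p ∧ dev (lift I) = I := by
  obtain ⟨n, rfl⟩ := Nat.exists_eq_add_of_le' hn1
  obtain ⟨ha, ω, φ, hφ, hg⟩ := mem_iSpaceK_iff.mp hI
  obtain ⟨hc, hg', hd⟩ := lift_spec hST hp hφ hn ha hg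
  exact ⟨(mem_hSpaceK_iff hST hp hn1 hn).mpr ⟨hc, ω, φ, hφ, hg'⟩, hd⟩

theorem mem_iSpaceK_dev [CompleteSpace V] (hST : S ≤ T) {p : ℝ} (hp : 1 ≤ p) (hn1 : 1 ≤ n)
    (hn : n ≤ ⌊p⌋₊) {H : Functional N S T n} (hH : H ∈ HSpaceK N S T n p) :
    dev H ∈ ISpaceK N S T n p ∧ lift (dev H) = H := by
  obtain ⟨n, rfl⟩ := Nat.exists_eq_add_of_le' hn1
  obtain ⟨hc, ω, φ, hφ, hg⟩ := (mem_hSpaceK_iff hST hp hn1 hn).mp hH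
  obtain ⟨ha, hg', hl⟩ := dev_spec hST hp hφ hn hc hg
  exact ⟨mem_iSpaceK_iff.mpr ⟨ha, ω, φ, hφ, hg'⟩, hl⟩

theorem IsAdditiveZero.add {I J : Functional N S T n} (hI : IsAdditiveZero I)
    (hJ : IsAdditiveZero J) : IsAdditiveZero (I + J) := by
  refine ⟨fun q => ?_, fun s u t hsu hut => ?_⟩
  · exact (congrArg₂ (· + ·) (hI.1 q) (hJ.1 q)).trans (add_zero _)
  · simp only [Pi.add_apply]
    rw [← hI.2 s u t hsu hut, ← hJ.2 s u t hsu hut]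
    abel

theorem IsAdditiveZero.smul {I : Functional N S T n} (hI : IsAdditiveZero I) (c : ℝ) :
    IsAdditiveZero (c • I) := by
  refine ⟨fun q => (congrArg (c • ·) (hI.1 q)).trans (smul_zero _), fun s u t hsu hut => ?_⟩
  simp only [Pi.smul_apply]
  rw [← hI.2 s u t hsu hut, smul_add]

theorem isAdditiveZero_zero : IsAdditiveZero (0 : Functional N S T n) :=
  ⟨fun _ => rfl, fun _ _ _ _ _ => add_zero _⟩

theorem hasGrowth_zero (p φ : ℝ) (ω : Control S T) :
    HasGrowth p φ ω (0 : Functional N S T n) :=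
  ⟨fun _ _ => ControlledBy.zero _ _, fun _ => ControlledBy.zero _ _⟩

theorem one_mem_Ioc {p : ℝ} (hp : 1 ≤ p) : (1 : ℝ) ∈ Set.Ioc (1 - 1 / p) 1 :=
  ⟨by linarith [one_div_pos.mpr (one_pos.trans_le hp)], le_rfl⟩

variable (N S T n) in
/-- The linear space `𝔍^{(n,p)}(V)`. -/
def iSubmodule {p : ℝ} (hp : 1 ≤ p) : Submodule ℝ (Functional N S T n) where
  carrier := ISpaceK N S T n p
  add_mem' {I J} hI hJ := by
    obtain ⟨ha, ω, φ, hφ, hg⟩ := mem_iSpaceK_iff.mp hI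
    obtain ⟨ha', ω', φ', hφ', hg'⟩ := mem_iSpaceK_iff.mp hJ
    obtain ⟨ω'', φ'', hφ'', h, h'⟩ := exists_common_growth hp hφ hφ' hg hg'
    exact mem_iSpaceK_iff.mpr ⟨ha.add ha', ω'', φ'', hφ'', h.add h'⟩
  zero_mem' := mem_iSpaceK_iff.mpr
    ⟨isAdditiveZero_zero, Control.zero S T, 1, one_mem_Ioc hp, hasGrowth_zero _ _ _⟩
  smul_mem' c I hI := by
    obtain ⟨ha, ω, φ, hφ, hg⟩ := mem_iSpaceK_iff.mp hI
    exact mem_iSpaceK_iff.mpr ⟨ha.smul c, ω, φ, hφ, hg.smul c⟩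

/-- The lift of the summed developments is multiplicative and `ω^{φ + 1/p}`-close to the pointwise
sum, so uniqueness of sewing identifies it with `H ⊞ H'`. -/
theorem boxplus_spec [CompleteSpace V] (hST : S ≤ T) {p : ℝ} (hp : 1 ≤ p) (hn1 : 1 ≤ n)
    (hn : n ≤ ⌊p⌋₊) {H H' : Functional N S T n} (hH : H ∈ HSpaceK N S T n p)
    (hH' : H' ∈ HSpaceK N S T n p) :
    SewingWellDefined p (oplus H H') ∧ boxplus H H' = lift (dev H + dev H') := by
  obtain ⟨n, rfl⟩ := Nat.exists_eq_add_of_le' hn1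
  obtain ⟨hc, ω₁, φ₁, hφ₁, hg₁⟩ := (mem_hSpaceK_iff hST hp hn1 hn).mp hH
  obtain ⟨hc', ω₂, φ₂, hφ₂, hg₂⟩ := (mem_hSpaceK_iff hST hp hn1 hn).mp hH'
  obtain ⟨ω, φ, hφ, hg, hg'⟩ := exists_common_growth hp hφ₁ hφ₂ hg₁ hg₂
  have hθ := one_lt_add_one_div hφ
  have hmem := oplus_mem_omegaAm hp hφ hn hc hc' hg hg'
  obtain ⟨ha, hd, hl⟩ := dev_spec hST hp hφ hn hc hg
  obtain ⟨ha', hd', hl'⟩ := dev_spec hST hp hφ hn hc' hg'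
  have hsub := levelControlled_lift_add_sub_oplus hST hp hφ hn ha ha' (ha.add ha') hd hd'
  rw [hl, hl'] at hsub
  obtain ⟨K, -, hK⟩ := hsub.exists_bound
  have hΩ : lift (dev H + dev H') ∈ HSpaceK N S T (n + 1) p :=
    (mem_hSpaceK_lift hST hp hn1 hn (mem_iSpaceK_iff.mpr
      ⟨ha.add ha', ω, φ, hφ, hd.add hd'⟩)).1
  exact ⟨sewingWellDefined_of_mem_omegaAm hST hθ hmem,
    ((isSewing_iff_eq_sewing hST hp hθ hmem _).mp ⟨hΩ.1, K, hK⟩).symm⟩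

theorem lift_zero [CompleteSpace V] (hST : S ≤ T) : lift (0 : Functional N S T n) = one N S T n := by
  rcases Nat.eq_zero_or_pos n with rfl | hn1
  · rfl
  obtain ⟨n, rfl⟩ := Nat.exists_eq_add_of_le' hn1
  have hp : (1 : ℝ) ≤ ((n + 1 : ℕ) : ℝ) := by exact_mod_cast hn1
  -- The statement does not involve `p`, so `p = n + 1` and `φ = 1` may be used. With the zero
  -- control, the growth bound forces all positive degrees to vanish.
  obtain ⟨hc, hg, -⟩ := lift_spec (p := ((n + 1 : ℕ) : ℝ)) hST hp (one_mem_Ioc hp)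
    (Nat.floor_natCast (n + 1)).ge (isAdditiveZero_zero (N := N) (S := S) (T := T))
    (hasGrowth_zero _ 1 (Control.zero S T))
  funext q i
  refine Fin.cases (motive := fun i => lift 0 q i = unit N (n + 1) i) (hc.1 q) (fun i => ?_) i
  obtain ⟨K, -, hK⟩ := hg.1 i.succ (by simp)
  have h := hK q
  rw [show (Control.zero S T) q = 0 from rfl, Real.rpow_one, mul_zero] at h
  exact norm_le_zero_iff.mp h

/-- The bijection between `𝓗^{(n,p)}(V)` and `𝔍^{(n,p)}(V)`. -/
def devEquiv [CompleteSpace V] (hST : S ≤ T) {p : ℝ} (hp : 1 ≤ p) (hn1 : 1 ≤ n)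
    (hn : n ≤ ⌊p⌋₊) : HSpaceK N S T n p ≃ iSubmodule N S T n hp where
  toFun H := ⟨dev H.1, (mem_iSpaceK_dev hST hp hn1 hn H.2).1⟩
  invFun I := ⟨lift I.1, (mem_hSpaceK_lift hST hp hn1 hn I.2).1⟩
  left_inv H := Subtype.ext (mem_iSpaceK_dev hST hp hn1 hn H.2).2
  right_inv I := Subtype.ext (mem_hSpaceK_lift hST hp hn1 hn I.2).2

end RoughPath

end

/-! ### The main theorem -/

open RoughPath in
theorem mainTheorem3 {V : Type*} [NormedAddCommGroup V] [NormedSpace ℝ V] [CompleteSpace V]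
    (N : AdmissibleNorms V) (S T : ℝ) (hST : S ≤ T) (p : ℝ) (hp : 1 ≤ p) :
    -- `𝔍^p(V)` is a linear space under the pointwise operations
    (∃ W : Submodule ℝ (Functional N S T ⌊p⌋₊), (W : Set (Functional N S T ⌊p⌋₊)) = ISpace N S T p) ∧
    -- the extensions used by `dev` (and hence by the lift) exist and are unique
    (∀ H ∈ HSpace N S T p, ∀ (k : ℕ), 1 ≤ k → ∀ hk : k < ⌊p⌋₊, ExtWellDefined (trunc hk.le H)) ∧
    -- the lift is a bijection from `𝔍^p(V)` onto `𝓗^p(V)` with inverse `dev`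
    (Set.BijOn lift (ISpace N S T p) (HSpace N S T p) ∧
      Set.InvOn dev lift (ISpace N S T p) (HSpace N S T p)) ∧
    -- the sewing that defines `H ⊞ H'` exists and is unique
    (∀ H ∈ HSpace N S T p, ∀ H' ∈ HSpace N S T p, SewingWellDefined p (oplus H H')) ∧
    -- `(𝓗^p(V), ⊞, ⊙)` is a real vector space with zero `𝟙`
    (∃ (_ : AddCommGroup (HSpace N S T p)) (_ : Module ℝ (HSpace N S T p)),
      (∀ H H' : HSpace N S T p, ((H + H' : HSpace N S T p) : Functional N S T ⌊p⌋₊)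
        = boxplus (H : Functional N S T ⌊p⌋₊) (H' : Functional N S T ⌊p⌋₊)) ∧
      (∀ (a : ℝ) (H : HSpace N S T p), ((a • H : HSpace N S T p) : Functional N S T ⌊p⌋₊)
        = odot a (H : Functional N S T ⌊p⌋₊)) ∧
      ((0 : HSpace N S T p) : Functional N S T ⌊p⌋₊) = one N S T ⌊p⌋₊) := by
  have hn1 := one_le_floor hp
  have hlift : ∀ I ∈ ISpace N S T p, lift I ∈ HSpace N S T p ∧ dev (lift I) = I :=
    fun I hI => mem_hSpaceK_lift hST hp hn1 le_rfl hI
  have hdev : ∀ H ∈ HSpace N S T p, dev H ∈ ISpace N S T p ∧ lift (dev H) = H :=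
    fun H hH => mem_iSpaceK_dev hST hp hn1 le_rfl hH
  have hinv : Set.InvOn dev lift (ISpace N S T p) (HSpace N S T p) :=
    ⟨fun I hI => (hlift I hI).2, fun H hH => (hdev H hH).2⟩
  refine ⟨⟨iSubmodule N S T ⌊p⌋₊ hp, rfl⟩, fun H hH k hk1 hk => ?_,
    ⟨hinv.bijOn (fun I hI => (hlift I hI).1) (fun H hH => (hdev H hH).1), hinv⟩,
    fun H hH H' hH' => (boxplus_spec hST hp hn1 le_rfl hH hH').1, ?_⟩
  · obtain ⟨hc, ω, φ, hφ, hg⟩ := (mem_hSpaceK_iff hST hp hn1 le_rfl).mp hH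
    exact (ext_of_levelControlled hST hp hφ hk1 hk (isChen_trunc hc hk.le)
      (levelControlled_trunc hg.1 hk.le)).1
  -- The vector space structure is pulled back along development, so scalar multiplication and zero
  -- unfold to `lift (a • dev H)` and `lift 0`; only the sum needs the sewing argument.
  · let e : HSpace N S T p ≃ iSubmodule N S T ⌊p⌋₊ hp := devEquiv hST hp hn1 le_rfl
    let _ : AddCommGroup (HSpace N S T p) := e.addCommGroup
    refine ⟨inferInstance, e.module ℝ, fun H H' => ?_, fun a H => rfl, lift_zero hST⟩
    exact (boxplus_spec hST hp hn1 le_rfl H.2 H'.2).2.symm
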